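/- **Lemma (instruction selection preserves semantics).** *Setting.* Cminor is an imperative language whose expressions are built from local variables, constants (32-bit integers, IEEE double floats, addresses of global symbols and of stack data), processor-independent unary and binary operators $\mathit{op}_1,\mathit{op}_2$, memory loads $\kappa[a]$ and conditional expressions $a_1\,?\,a_2:a_3$. CminorSel is the variant of Cminor whose expressions are variables, applications $\mathit{op}(\vec a)$ of PowerPC operators, loads $\mathtt{load}(\kappa,\mathit{mode},\vec a)$ through machine addressing modes, and conditional expressions $\mathit{ce}\,?\,a_1:a_2$ over a separate syntactic class of condition expressions $\mathit{ce}$; its stores use addressing modes and its $\mathtt{if}$ statements use condition expressions; all other statements are as in Cminor. Both languages have a big-step evaluation judgment $G,\sigma,E,M\vdash a\Rightarrow v$ for expressions ($G$ global environment, $\sigma$ stack block, $E$ local environment, $M$ memory state; for CminorSel also $G,\sigma,E,M\vdash \mathit{ce}\Rightarrow\mathtt{true}/\mathtt{false}$), and a labeled transition relation $G\vdash S\xrightarrow{t}S'$ on regular states $\mathcal S(F,s,k,\sigma,E,M)$, call states $\mathcal C(\mathit{Fd},\vec v,k,M)$ and return states $\mathcal R(v,k,M)$, where $k$ is a continuation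 and $t$ is the trace of external calls. A program $P$ has behavior $B$, written $P\Downarrow B$, where $B$ is convergence with a trace and an exit code, divergence with a finite or infinite trace, or going wrong ($B\in\mathtt{Wrong}$), according to the transition sequences that start in its initial states. Instruction selection translates a Cminor expression $a$ bottom-up to a CminorSel expression $[a]$, by means of smart constructors $\overline{\mathit{op}_1}$, $\overline{\mathit{op}_2}$ (which recognize immediate and combined machine operators, fold constants, and reassociate additions and multiplications), $\overline{\mathtt{cond}}$ (which turns an expression into a condition expression) and $\overline{\mathtt{mode}}$ (which turns an address expression into an addressing mode with its arguments). It is extended structurally to statements $[s]$, functions $[F]$, $[\mathit{Fd}]$, continuations $[k]$ and programs. Let $P$ be a Cminor program, $P'$ its translation, and $G,G'$ the global environments of $P,P'$. Define $\sim$ between Cminor states and CminorSel states by $$\mathcal S(F,s,k,\sigma,E,M)\sim\mathcal S([F],[s],[k],\sigma,E,M),\qquad \mathcal C(\mathit{Fd},\vec v,k,M)\sim\mathcal C([\mathit{Fd}],\vec v,[k],M),\qquad \mathcal R(v,k,M)\sim\mathcal R(v,[k],M).$$ *Statement.* The following hold. 1. (Smart constructors.) For all CminorSel expressions $a,a_1,a_2$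 and every CminorSel global environment $G_0$ and all $\sigma,E,M$: - if $G_0,\sigma,E,M\vdash a_1\Rightarrow v_1$ and the Cminor operator $\mathit{op}_1$ applied to $v_1$ has value $v$, then $G_0,\sigma,E,M\vdash\overline{\mathit{op}_1}(a_1)\Rightarrow v$; - if $G_0,\sigma,E,M\vdash a_1\Rightarrow v_1$ and $G_0,\sigma,E,M\vdash a_2\Rightarrow v_2$ and the Cminor operator $\mathit{op}_2$ applied to $v_1,v_2$ has value $v$, then $G_0,\sigma,E,M\vdash\overline{\mathit{op}_2}(a_1,a_2)\Rightarrow v$; - if $G_0,\sigma,E,M\vdash a\Rightarrow v$ and $v$ is true (a pointer or a non-zero integer), resp. false (the integer $0$), then $\overline{\mathtt{cond}}(a)$ evaluates to $\mathtt{true}$, resp. $\mathtt{false}$, in $G_0,\sigma,E,M$; - if $G_0,\sigma,E,M\vdash a\Rightarrow v$ where $v$ is a pointer, and $\overline{\mathtt{mode}}(a)=(\mathit{mode},\vec a)$, then there is $\vec v$ such that $G_0,\sigma,E,M\vdash\vec a\Rightarrow\vec v$ and the addressing mode $\mathit{mode}$ applied to $\vec v$ yields $v$. 2. (Expressions.)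 If $G,\sigma,E,M\vdash a\Rightarrow v$ in Cminor, then $G',\sigma,E,M\vdash[a]\Rightarrow v$ in CminorSel. 3. (Lock-step simulation.) If $G\vdash S_1\xrightarrow{t}S_2$ and $S_1\sim S_1'$, then there exists $S_2'$ such that $G'\vdash S_1'\xrightarrow{t}S_2'$ and $S_2\sim S_2'$. 4. (Semantic preservation.) For every behavior $B\notin\mathtt{Wrong}$, if $P\Downarrow B$ then $P'\Downarrow B$. -/

import Mathlib

namespace BackEnd

/-! ## Machine integers, floats, values -/

abbrev Ident := ℕ
abbrev Label := ℕ
/-- 32-bit machine integers. -/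
abbrev Word := BitVec 32
/-- Block identifiers: positive for data, negative for functions. -/
abbrev Block := ℤ

inductive Ty where
  | int | float
  deriving DecidableEq

structure Sig where
  args : List Ty
  /-- `none` stands for `void`. -/
  res : Option Ty
  deriving DecidableEq

inductive Val where
  | int (n : Word)
  | float (f : Float)
  | ptr (b : Block) (δ : Word)
  | undef

namespace Val

def isTrue : Val → Prop
  | int n => n ≠ 0
  | ptr _ _ => True
  | _ => False

def isFalse : Val → Prop
  | int n => n = 0
  | _ => False

def ofBool (b : Bool) : Val := int (if b then 1 else 0)

end Val

namespace Word

def cast8u (n : Word) : Word := (n.setWidth 8).setWidth 32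
def cast8s (n : Word) : Word := (n.setWidth 8).signExtend 32
def cast16u (n : Word) : Word := (n.setWidth 16).setWidth 32
def cast16s (n : Word) : Word := (n.setWidth 16).signExtend 32

/-- Left rotation; the amount counts modulo 32. -/
def rol (x n : Word) : Word := x.rotateLeft n.toNat

/-- Rotate left, then mask. -/
def rolm (x n m : Word) : Word := rol x n &&& m

end Word

inductive Cmp where
  | eq | ne | gt | ge | lt | le
  deriving DecidableEq

namespace Cmp

def negate : Cmp → Cmp
  | eq => ne | ne => eq | gt => le | ge => lt | lt => ge | le => gt

def swap : Cmp → Cmp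
  | eq => eq | ne => ne | gt => lt | ge => le | lt => gt | le => ge

/-- Signed comparison. -/
def evalInt (c : Cmp) (x y : Word) : Bool :=
  match c with
  | eq => x == y
  | ne => x != y
  | gt => y.slt x
  | ge => y.sle x
  | lt => x.slt y
  | le => x.sle y

/-- Unsigned comparison. -/
def evalIntu (c : Cmp) (x y : Word) : Bool :=
  match c with
  | eq => x == y
  | ne => x != y
  | gt => y.ult x
  | ge => y.ule x
  | lt => x.ult y
  | le => x.ule y

/-- IEEE 754 comparison (all but `ne` are false on NaN). -/
def evalFloat (c : Cmp) (x y : Float) : Bool :=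
  match c with
  | eq => Float.beq x y
  | ne => ! Float.beq x y
  | gt => Float.lt y x
  | ge => Float.le y x
  | lt => Float.lt x y
  | le => Float.le x y

/-- Comparison of pointers to distinct blocks, or of a pointer with the null pointer. -/
def evalMismatch : Cmp → Option Bool
  | eq => some false
  | ne => some true
  | _ => none

/-- Comparison of a pointer with an integer: defined only against 0. -/
def evalNull (c : Cmp) (n : Word) : Option Bool :=
  if n = 0 then c.evalMismatch else none

/-- Signed integer and pointer comparison of values. -/
def evalVal (c : Cmp) : Val → Val → Option Bool
  | .int n₁, .int n₂ => some (c.evalInt n₁ n₂)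
  | .ptr b₁ δ₁, .ptr b₂ δ₂ => if b₁ = b₂ then some (c.evalInt δ₁ δ₂) else c.evalMismatch
  | .ptr _ _, .int n => c.evalNull n
  | .int n, .ptr _ _ => c.evalNull n
  | _, _ => none

/-- Unsigned integer comparison of values. -/
def evalValu (c : Cmp) : Val → Val → Option Bool
  | .int n₁, .int n₂ => some (c.evalIntu n₁ n₂)
  | _, _ => none

/-- Float comparison of values. -/
def evalValf (c : Cmp) : Val → Val → Option Bool
  | .float f₁, .float f₂ => some (c.evalFloat f₁ f₂)
  | _, _ => none

end Cmp

namespace Fl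

/-- Rounds a double to the nearest single-precision number, again seen as a double. -/
def single (f : Float) : Float :=
  match f.toModel.unpack with
  | .finite s m e _ =>
    match Float.Model.UnpackedFloat.unpack Float.Model.Format.binary32
        (Float.Model.UnpackedFloat.pack Float.Model.Format.binary32
          (Float.Model.UnpackedFloat.round Float.Model.Format.binary32 s m e)) with
    | .finite s' m' e' _ =>
      ⟨Float.Model.pack (Float.Model.UnpackedFloat.round Float.Model.Format.binary64 s' m' e')⟩
    | u => ⟨Float.Model.pack u⟩
  | _ => f

def ofSigned (n : Word) : Float := ⟨Float.Model.ofInt n.toInt⟩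
def ofUnsigned (n : Word) : Float := ⟨Float.Model.ofNat n.toNat⟩

/-- The integer obtained by truncating a finite float towards zero. -/
def trunc (f : Float) : Option ℤ :=
  if f.isFinite then some (f.toModel.unpack.toInt 0 0) else none

/-- Conversion to a signed integer, undefined if out of range. -/
def toSigned (f : Float) : Option Word :=
  (trunc f).bind fun z =>
    if -2 ^ 31 ≤ z ∧ z < 2 ^ 31 then some (BitVec.ofInt 32 z) else none

/-- Conversion to an unsigned integer, undefined if out of range. -/
def toUnsigned (f : Float) : Option Word :=
  (trunc f).bind fun z =>
    if 0 ≤ z ∧ z < 2 ^ 32 then some (BitVec.ofInt 32 z) else none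

end Fl

/-! ## Memory states -/

/-- Memory quantities. -/
inductive Chunk where
  | int8signed | int8unsigned | int16signed | int16unsigned | int32 | float32 | float64
  deriving DecidableEq

namespace Chunk

def size : Chunk → ℕ
  | int8signed => 1 | int8unsigned => 1
  | int16signed => 2 | int16unsigned => 2
  | int32 => 4 | float32 => 4 | float64 => 8

/-- Truncation or extension of a value as prescribed by a memory quantity. -/
def cast : Chunk → Val → Val
  | int8signed, .int n => .int (Word.cast8s n)
  | int8unsigned, .int n => .int (Word.cast8u n)
  | int16signed, .int n => .int (Word.cast16s n)
  | int16unsigned, .int n => .int (Word.cast16u n)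
  | int32, .int n => .int n
  | int32, .ptr b δ => .ptr b δ
  | float32, .float f => .float (Fl.single f)
  | float64, .float f => .float f
  | _, _ => .undef

end Chunk

/-- What a block holds at a byte offset: nothing, the first byte of a value stored on `size`
bytes, or another byte of such a value. -/
inductive Content where
  | undef
  | datum (size : ℕ) (v : Val)
  | cont

namespace Content

def write (size : ℕ) (δ : ℤ) (v : Val) (c : ℤ → Content) : ℤ → Content := fun i =>
  if i = δ then datum size v
  else if δ < i ∧ i < δ + size then cont
  else c i

open Classical in
noncomputable def read (size : ℕ) (δ : ℤ) (c : ℤ → Content) : Val :=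
  match c δ with
  | datum size' v =>
    if size' = size ∧ ∀ i, δ < i → i < δ + size → c i = cont then v else .undef
  | _ => .undef

end Content

/-- A block with bounds `[lo, hi)`. -/
structure BlockData where
  lo : ℤ
  hi : ℤ
  contents : ℤ → Content

def BlockData.empty : BlockData := ⟨0, 0, fun _ => .undef⟩

/-- Memory states; the blocks allocated so far are those below `next`. -/
structure Mem where
  next : Block
  blocks : Block → BlockData
  next_pos : 0 < next

namespace Mem

def alloc (M : Mem) (l h : ℤ) : Block × Mem :=
  (M.next,
    { next := M.next + 1
      blocks := fun b => if b = M.next then ⟨l, h, fun _ => .undef⟩ else M.blocks b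
      next_pos := Int.add_pos M.next_pos Int.one_pos })

def free (M : Mem) (b : Block) : Mem :=
  { M with blocks := fun b' => if b' = b then BlockData.empty else M.blocks b' }

def validAccess (M : Mem) (κ : Chunk) (b : Block) (δ : Word) : Prop :=
  b < M.next ∧ (M.blocks b).lo ≤ δ.toInt ∧ δ.toInt + κ.size ≤ (M.blocks b).hi

instance (M : Mem) (κ : Chunk) (b : Block) (δ : Word) : Decidable (M.validAccess κ b δ) :=
  inferInstanceAs (Decidable (_ ∧ _ ∧ _))

noncomputable def load (M : Mem) (κ : Chunk) (b : Block) (δ : Word) : Option Val :=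
  if M.validAccess κ b δ then
    some (κ.cast (Content.read κ.size δ.toInt (M.blocks b).contents))
  else none

def store (M : Mem) (κ : Chunk) (b : Block) (δ : Word) (v : Val) : Option Mem :=
  if M.validAccess κ b δ then
    some { M with
      blocks := fun b' =>
        if b' = b then
          { M.blocks b with contents := Content.write κ.size δ.toInt v (M.blocks b).contents }
        else M.blocks b' }
  else none

end Mem

/-! ## Programs and global environments -/

inductive InitData where
  | reserve (n : ℕ)
  | int8 (n : Word)
  | int16 (n : Word)
  | int32 (n : Word)
  | float32 (f : Float)
  | float64 (f : Float)

namespace InitData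

def size : InitData → ℕ
  | reserve n => n
  | int8 _ => 1 | int16 _ => 2 | int32 _ => 4 | float32 _ => 4 | float64 _ => 8

/-- Contents of a block initialized by a list of data, starting at offset `δ`. -/
def contents (δ : ℤ) : List InitData → ℤ → Content
  | [] => fun _ => .undef
  | d :: ds =>
    let c := contents (δ + d.size) ds
    match d with
    | reserve _ => c
    | int8 n => Content.write 1 δ (.int n) c
    | int16 n => Content.write 2 δ (.int n) c
    | int32 n => Content.write 4 δ (.int n) c
    | float32 f => Content.write 4 δ (.float f) c
    | float64 f => Content.write 8 δ (.float f) c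

def toBlock (ds : List InitData) : BlockData :=
  ⟨0, ((ds.map size).sum : ℕ), contents 0 ds⟩

end InitData

structure ExtFun where
  tag : Ident
  sig : Sig

inductive FunDef (F : Type) where
  | internal (f : F)
  | external (fe : ExtFun)

structure Prog (F : Type) where
  vars : List (Ident × List InitData)
  functs : List (Ident × FunDef F)
  main : Ident

def FunDef.map {F F' : Type} (tr : F → F') : FunDef F → FunDef F'
  | internal f => internal (tr f)
  | external fe => external fe

def Prog.map {F F' : Type} (tr : F → F') (P : Prog F) : Prog F' where
  vars := P.vars
  functs := P.functs.map fun p => (p.1, p.2.map tr)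
  main := P.main

/-- Global environments: function definitions by block, blocks by identifier. -/
structure GEnv (F : Type) where
  funct : Block → Option (FunDef F)
  symbol : Ident → Option Block

/-- Block allocation is deterministic: the `i`-th function gets block `-(i+1)`, the `j`-th variable block `j+1`. -/
def Prog.globalEnv {F : Type} (P : Prog F) : GEnv F where
  funct := fun b => if b < 0 then (P.functs[(-b - 1).toNat]?).map (·.2) else none
  symbol := fun id =>
    match P.functs.findIdx? (fun p => p.1 == id) with
    | some i => some (-((i : ℤ) + 1))
    | none => (P.vars.findIdx? (fun p => p.1 == id)).map fun j => (j : ℤ) + 1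

def Prog.initMem {F : Type} (P : Prog F) : Mem where
  next := (P.vars.length : ℤ) + 1
  blocks := fun b =>
    if 0 < b then
      match P.vars[(b - 1).toNat]? with
      | some p => InitData.toBlock p.2
      | none => BlockData.empty
    else BlockData.empty
  next_pos := Int.lt_add_one_of_le (Int.natCast_nonneg _)

/-! ## Traces, behaviors, transition semantics -/

inductive EventVal where
  | int (n : Word)
  | float (f : Float)

namespace EventVal

def toVal : EventVal → Val
  | int n => .int n
  | float f => .float f

def ty : EventVal → Ty
  | int _ => .int
  | float _ => .float

end EventVal

structure Event where
  tag : Ident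
  args : List EventVal
  res : EventVal

/-- Finite traces. -/
abbrev Trace := List Event
/-- Finite or infinite traces. -/
abbrev TraceInf := Stream'.Seq Event

inductive Behavior where
  | converges (t : Trace) (n : Word)
  | diverges (T : TraceInf)
  | goesWrong (t : Trace)

/-- The set of going-wrong behaviors. -/
def Wrong : Set Behavior := {B | ∃ t, B = .goesWrong t}

/-- Effect of an external call. By convention the result of a `void` external function is an
integer. -/
inductive ExtCall (fe : ExtFun) : List Val → Trace → Val → Prop
  | intro (args : List EventVal) (r : EventVal)
      (hargs : args.map EventVal.ty = fe.sig.args)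
      (hres : r.ty = fe.sig.res.getD Ty.int) :
      ExtCall fe (args.map EventVal.toVal) [⟨fe.tag, args, r⟩] r.toVal

/-- Zero, one or several transitions. -/
inductive Star {S : Type} (step : S → Trace → S → Prop) : S → Trace → S → Prop
  | refl (s : S) : Star step s [] s
  | step {s s' s'' : S} {t₁ t₂ : Trace} :
      step s t₁ s' → Star step s' t₂ s'' → Star step s (t₁ ++ t₂) s''

/-- An infinite sequence of transitions, as a greatest fixpoint. -/
def Forever {S : Type} (step : S → Trace → S → Prop) (s : S) (T : TraceInf) : Prop :=
  ∃ R : S → TraceInf → Prop, R s T ∧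
    ∀ s T, R s T → ∃ t s' T',
      step s t s' ∧ T = (Stream'.Seq.ofList t).append T' ∧ R s' T'

/-- The observable behaviors of a transition system. -/
inductive Behaves {S : Type} (step : S → Trace → S → Prop) (initial : S → Prop)
    (final : S → Word → Prop) : Behavior → Prop
  | converges {s s' : S} {t : Trace} {n : Word} :
      initial s → Star step s t s' → final s' n →
      Behaves step initial final (.converges t n)
  | diverges {s : S} {T : TraceInf} :
      initial s → Forever step s T → Behaves step initial final (.diverges T)
  | goesWrong {s s' : S} {t : Trace} :
      initial s → Star step s t s' → (∀ t' s'', ¬ step s' t' s'') → (∀ n, ¬ final s' n) →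
      Behaves step initial final (.goesWrong t)

/-! ## Elements shared by both languages -/

/-- Local variable environments. -/
abbrev Env := Ident → Option Val

namespace Env

def set (E : Env) (id : Ident) (v : Val) : Env := fun id' => if id' = id then some v else E id'

def setOpt (E : Env) : Option Ident → Val → Env
  | none, _ => E
  | some id, v => E.set id v

/-- Binds parameters to arguments; missing arguments are `undef`. -/
def ofParams : List Ident → List Val → Env
  | [], _ => fun _ => none
  | id :: ids, [] => (ofParams ids []).set id .undef
  | id :: ids, v :: vs => (ofParams ids vs).set id v

def setVars (E : Env) : List Ident → Env
  | [] => E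
  | id :: ids => (setVars E ids).set id .undef

/-- The environment at function entry. -/
def entry (params vars : List Ident) (args : List Val) : Env :=
  (ofParams params args).setVars vars

end Env

inductive SwitchTable where
  | default (n : ℕ)
  | case (i : Word) (n : ℕ) (tbl : SwitchTable)

def SwitchTable.target : SwitchTable → Word → ℕ
  | default n, _ => n
  | case i n tbl, x => if x = i then n else tbl.target x

/-! ## Cminor -/

namespace Cminor

inductive Const where
  | int (n : Word)
  | float (f : Float)
  | addrsymbol (id : Ident)
  | addrstack (δ : Word)

inductive Unop where
  | negint | notint | notbool
  | negf | absf
  | cast8u | cast8s | cast16u | cast16s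
  | singleoffloat
  | intoffloat | intuoffloat
  | floatofint | floatofintu

inductive Binop where
  | add | sub | mul | div | divu | mod | modu
  | and | or | xor | shl | shr | shru
  | addf | subf | mulf | divf
  | cmp (c : Cmp) | cmpu (c : Cmp) | cmpf (c : Cmp)

inductive Expr where
  | var (id : Ident)
  | const (c : Const)
  | unop (op : Unop) (a : Expr)
  | binop (op : Binop) (a₁ a₂ : Expr)
  | load (κ : Chunk) (a : Expr)
  | cond (a₁ a₂ a₃ : Expr)

inductive Stmt where
  | skip
  | assign (id : Ident) (a : Expr)
  | store (κ : Chunk) (a₁ a₂ : Expr)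
  | call (id : Option Ident) (a : Expr) (args : List Expr) (sig : Sig)
  | tailcall (a : Expr) (args : List Expr) (sig : Sig)
  | ret (a : Option Expr)
  | seq (s₁ s₂ : Stmt)
  | ite (a : Expr) (s₁ s₂ : Stmt)
  | loop (s : Stmt)
  | block (s : Stmt)
  | exit (n : ℕ)
  | switch (a : Expr) (tbl : SwitchTable)
  | label (lbl : Label) (s : Stmt)
  | goto (lbl : Label)

structure Func where
  sig : Sig
  params : List Ident
  vars : List Ident
  stacksize : ℕ
  body : Stmt

abbrev Fundef := FunDef Func
abbrev Program := Prog Func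

def sigOf : Fundef → Sig
  | .internal F => F.sig
  | .external fe => fe.sig

def evalConst (G : GEnv Func) (σ : Block) : Const → Option Val
  | .int n => some (.int n)
  | .float f => some (.float f)
  | .addrsymbol id => (G.symbol id).map fun b => .ptr b 0
  | .addrstack δ => some (.ptr σ δ)

def evalUnop : Unop → Val → Option Val
  | .negint, .int n => some (.int (-n))
  | .notint, .int n => some (.int (~~~n))
  | .notbool, .int n => some (Val.ofBool (n == 0))
  | .notbool, .ptr _ _ => some (Val.ofBool false)
  | .negf, .float f => some (.float (Float.neg f))
  | .absf, .float f => some (.float (Float.abs f))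
  | .cast8u, .int n => some (.int (Word.cast8u n))
  | .cast8s, .int n => some (.int (Word.cast8s n))
  | .cast16u, .int n => some (.int (Word.cast16u n))
  | .cast16s, .int n => some (.int (Word.cast16s n))
  | .singleoffloat, .float f => some (.float (Fl.single f))
  | .intoffloat, .float f => (Fl.toSigned f).map .int
  | .intuoffloat, .float f => (Fl.toUnsigned f).map .int
  | .floatofint, .int n => some (.float (Fl.ofSigned n))
  | .floatofintu, .int n => some (.float (Fl.ofUnsigned n))
  | _, _ => none

def evalBinop : Binop → Val → Val → Option Val
  | .add, .int n₁, .int n₂ => some (.int (n₁ + n₂))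
  | .add, .ptr b δ, .int n => some (.ptr b (δ + n))
  | .add, .int n, .ptr b δ => some (.ptr b (δ + n))
  | .sub, .int n₁, .int n₂ => some (.int (n₁ - n₂))
  | .sub, .ptr b δ, .int n => some (.ptr b (δ - n))
  | .sub, .ptr b₁ δ₁, .ptr b₂ δ₂ => if b₁ = b₂ then some (.int (δ₁ - δ₂)) else none
  | .mul, .int n₁, .int n₂ => some (.int (n₁ * n₂))
  | .div, .int n₁, .int n₂ => if n₂ = 0 then none else some (.int (n₁.sdiv n₂))
  | .divu, .int n₁, .int n₂ => if n₂ = 0 then none else some (.int (n₁.udiv n₂))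
  | .mod, .int n₁, .int n₂ => if n₂ = 0 then none else some (.int (n₁.srem n₂))
  | .modu, .int n₁, .int n₂ => if n₂ = 0 then none else some (.int (n₁.umod n₂))
  | .and, .int n₁, .int n₂ => some (.int (n₁ &&& n₂))
  | .or, .int n₁, .int n₂ => some (.int (n₁ ||| n₂))
  | .xor, .int n₁, .int n₂ => some (.int (n₁ ^^^ n₂))
  | .shl, .int n₁, .int n₂ => if n₂.toNat < 32 then some (.int (n₁ <<< n₂.toNat)) else none
  | .shr, .int n₁, .int n₂ =>
    if n₂.toNat < 32 then some (.int (n₁.sshiftRight n₂.toNat)) else none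
  | .shru, .int n₁, .int n₂ => if n₂.toNat < 32 then some (.int (n₁ >>> n₂.toNat)) else none
  | .addf, .float f₁, .float f₂ => some (.float (Float.add f₁ f₂))
  | .subf, .float f₁, .float f₂ => some (.float (Float.sub f₁ f₂))
  | .mulf, .float f₁, .float f₂ => some (.float (Float.mul f₁ f₂))
  | .divf, .float f₁, .float f₂ => some (.float (Float.div f₁ f₂))
  | .cmp c, v₁, v₂ => (c.evalVal v₁ v₂).map Val.ofBool
  | .cmpu c, v₁, v₂ => (c.evalValu v₁ v₂).map Val.ofBool
  | .cmpf c, v₁, v₂ => (c.evalValf v₁ v₂).map Val.ofBool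
  | _, _, _ => none

inductive EvalExpr (G : GEnv Func) (σ : Block) (E : Env) (M : Mem) : Expr → Val → Prop
  | var {id v} : E id = some v → EvalExpr G σ E M (.var id) v
  | const {c v} : evalConst G σ c = some v → EvalExpr G σ E M (.const c) v
  | unop {op a₁ v₁ v} :
      EvalExpr G σ E M a₁ v₁ → evalUnop op v₁ = some v → EvalExpr G σ E M (.unop op a₁) v
  | binop {op a₁ a₂ v₁ v₂ v} :
      EvalExpr G σ E M a₁ v₁ → EvalExpr G σ E M a₂ v₂ → evalBinop op v₁ v₂ = some v →
      EvalExpr G σ E M (.binop op a₁ a₂) v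
  | load {κ a₁ b δ v} :
      EvalExpr G σ E M a₁ (.ptr b δ) → M.load κ b δ = some v → EvalExpr G σ E M (.load κ a₁) v
  | cond_true {a₁ a₂ a₃ v₁ v₂} :
      EvalExpr G σ E M a₁ v₁ → v₁.isTrue → EvalExpr G σ E M a₂ v₂ →
      EvalExpr G σ E M (.cond a₁ a₂ a₃) v₂
  | cond_false {a₁ a₂ a₃ v₁ v₃} :
      EvalExpr G σ E M a₁ v₁ → v₁.isFalse → EvalExpr G σ E M a₃ v₃ →
      EvalExpr G σ E M (.cond a₁ a₂ a₃) v₃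

inductive EvalExprs (G : GEnv Func) (σ : Block) (E : Env) (M : Mem) : List Expr → List Val → Prop
  | nil : EvalExprs G σ E M [] []
  | cons {a as v vs} :
      EvalExpr G σ E M a v → EvalExprs G σ E M as vs → EvalExprs G σ E M (a :: as) (v :: vs)

/-- Continuations; `empty` is the initial one. -/
inductive Cont where
  | empty
  | seq (s : Stmt) (k : Cont)
  | endblock (k : Cont)
  | returnto (id : Option Ident) (F : Func) (σ : Block) (E : Env) (k : Cont)

def callcont : Cont → Cont
  | .seq _ k => callcont k
  | .endblock k => callcont k
  | .empty => .empty
  | .returnto id F σ E k => .returnto id F σ E k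

def Cont.isCall : Cont → Prop
  | .empty => True
  | .returnto _ _ _ _ _ => True
  | _ => False

def findlabel (lbl : Label) : Stmt → Cont → Option (Stmt × Cont)
  | .seq s₁ s₂, k =>
    match findlabel lbl s₁ (.seq s₂ k) with
    | some r => some r
    | none => findlabel lbl s₂ k
  | .ite _ s₁ s₂, k =>
    match findlabel lbl s₁ k with
    | some r => some r
    | none => findlabel lbl s₂ k
  | .loop s, k => findlabel lbl s (.seq (.loop s) k)
  | .block s, k => findlabel lbl s (.endblock k)
  | .label lbl' s, k => if lbl' = lbl then some (s, k) else findlabel lbl s k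
  | _, _ => none

inductive State where
  | regular (F : Func) (s : Stmt) (k : Cont) (σ : Block) (E : Env) (M : Mem)
  | call (Fd : Fundef) (args : List Val) (k : Cont) (M : Mem)
  | ret (v : Val) (k : Cont) (M : Mem)

inductive Step (G : GEnv Func) : State → Trace → State → Prop
  | skip_seq {F s k σ E M} :
      Step G (.regular F .skip (.seq s k) σ E M) [] (.regular F s k σ E M)
  | skip_endblock {F k σ E M} :
      Step G (.regular F .skip (.endblock k) σ E M) [] (.regular F .skip k σ E M)
  | assign {F id a k σ E M v} :
      EvalExpr G σ E M a v →
      Step G (.regular F (.assign id a) k σ E M) [] (.regular F .skip k σ (E.set id v) M)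
  | store {F κ a₁ a₂ k σ E M b δ v M'} :
      EvalExpr G σ E M a₁ (.ptr b δ) → EvalExpr G σ E M a₂ v → M.store κ b δ v = some M' →
      Step G (.regular F (.store κ a₁ a₂) k σ E M) [] (.regular F .skip k σ E M')
  | seq {F s₁ s₂ k σ E M} :
      Step G (.regular F (.seq s₁ s₂) k σ E M) [] (.regular F s₁ (.seq s₂ k) σ E M)
  | ite_true {F a s₁ s₂ k σ E M v} :
      EvalExpr G σ E M a v → v.isTrue →
      Step G (.regular F (.ite a s₁ s₂) k σ E M) [] (.regular F s₁ k σ E M)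
  | ite_false {F a s₁ s₂ k σ E M v} :
      EvalExpr G σ E M a v → v.isFalse →
      Step G (.regular F (.ite a s₁ s₂) k σ E M) [] (.regular F s₂ k σ E M)
  | loop {F s k σ E M} :
      Step G (.regular F (.loop s) k σ E M) [] (.regular F s (.seq (.loop s) k) σ E M)
  | block {F s k σ E M} :
      Step G (.regular F (.block s) k σ E M) [] (.regular F s (.endblock k) σ E M)
  | exit_seq {F n s k σ E M} :
      Step G (.regular F (.exit n) (.seq s k) σ E M) [] (.regular F (.exit n) k σ E M)
  | exit_zero {F k σ E M} :
      Step G (.regular F (.exit 0) (.endblock k) σ E M) [] (.regular F .skip k σ E M)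
  | exit_succ {F n k σ E M} :
      Step G (.regular F (.exit (n + 1)) (.endblock k) σ E M) [] (.regular F (.exit n) k σ E M)
  | switch {F a tbl k σ E M n} :
      EvalExpr G σ E M a (.int n) →
      Step G (.regular F (.switch a tbl) k σ E M) [] (.regular F (.exit (tbl.target n)) k σ E M)
  | label {F lbl s k σ E M} :
      Step G (.regular F (.label lbl s) k σ E M) [] (.regular F s k σ E M)
  | goto {F lbl k σ E M s' k'} :
      findlabel lbl F.body (callcont k) = some (s', k') →
      Step G (.regular F (.goto lbl) k σ E M) [] (.regular F s' k' σ E M)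
  | call {F id a as sig k σ E M b vs Fd} :
      EvalExpr G σ E M a (.ptr b 0) → EvalExprs G σ E M as vs →
      G.funct b = some Fd → sigOf Fd = sig →
      Step G (.regular F (.call id a as sig) k σ E M) [] (.call Fd vs (.returnto id F σ E k) M)
  | tailcall {F a as sig k σ E M b vs Fd} :
      EvalExpr G σ E M a (.ptr b 0) → EvalExprs G σ E M as vs →
      G.funct b = some Fd → sigOf Fd = sig →
      Step G (.regular F (.tailcall a as sig) k σ E M) []
        (.call Fd vs (callcont k) (M.free σ))
  | skip_call {F k σ E M} :
      F.sig.res = none → k.isCall →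
      Step G (.regular F .skip k σ E M) [] (.ret .undef k (M.free σ))
  | ret_none {F k σ E M} :
      F.sig.res = none →
      Step G (.regular F (.ret none) k σ E M) [] (.ret .undef (callcont k) (M.free σ))
  | ret_some {F a k σ E M v} :
      F.sig.res ≠ none → EvalExpr G σ E M a v →
      Step G (.regular F (.ret (some a)) k σ E M) [] (.ret v (callcont k) (M.free σ))
  | internal {F vs k M σ M'} :
      M.alloc 0 F.stacksize = (σ, M') →
      Step G (.call (.internal F) vs k M) []
        (.regular F F.body k σ (Env.entry F.params F.vars vs) M')
  | external {fe vs k M t v} :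
      ExtCall fe vs t v → Step G (.call (.external fe) vs k M) t (.ret v k M)
  | ret {v id F σ E k M} :
      Step G (.ret v (.returnto id F σ E k) M) [] (.regular F .skip k σ (E.setOpt id v) M)

inductive Initial (P : Program) : State → Prop
  | intro {b Fd} :
      P.globalEnv.symbol P.main = some b → P.globalEnv.funct b = some Fd →
      Initial P (.call Fd [] .empty P.initMem)

inductive Final : State → Word → Prop
  | intro {n M} : Final (.ret (.int n) .empty M) n

def Exec (P : Program) : Behavior → Prop :=
  Behaves (Step P.globalEnv) (Initial P) Final

end Cminor

/-! ## CminorSel -/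

namespace CminorSel

/-- Elementary conditions of the target processor. -/
inductive Test where
  | comp (c : Cmp)
  | compimm (c : Cmp) (n : Word)
  | compu (c : Cmp)
  | compuimm (c : Cmp) (n : Word)
  | compf (c : Cmp)
  deriving DecidableEq

/-- Operators of the target processor. -/
inductive Op where
  | intconst (n : Word)
  | floatconst (f : Float)
  | addrsymbol (id : Ident) (δ : Word)
  | addrstack (δ : Word)
  | move
  | negint | notbool
  | cast8u | cast8s | cast16u | cast16s
  | add | addi (n : Word)
  | sub | subi (n : Word)
  | mul | muli (n : Word)
  | div | divu
  | and | andi (n : Word)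
  | or | ori (n : Word)
  | xor | xori (n : Word)
  | nand | nor | nxor
  | shl | shr | shri (n : Word) | shru
  | rolm (n m : Word)
  | negf | absf | addf | subf | mulf | divf
  | singleoffloat | intoffloat | intuoffloat | floatofint | floatofintu
  | cmp (c : Test)
  deriving DecidableEq

/-- Addressing modes of the target processor. -/
inductive Mode where
  | indexed (n : Word)
  | indexed2
  | global (id : Ident) (δ : Word)
  | based (id : Ident) (δ : Word)
  | stack (δ : Word)
  deriving DecidableEq

mutual
inductive Expr where
  | var (id : Ident)
  | op (o : Op) (as : Exprs)
  | load (κ : Chunk) (mode : Mode) (as : Exprs)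
  | cond (ce : CondExpr) (a₁ a₂ : Expr)
  deriving DecidableEq
inductive CondExpr where
  | tru
  | fls
  | test (c : Test) (as : Exprs)
  | cond (ce₁ ce₂ ce₃ : CondExpr)
  deriving DecidableEq
inductive Exprs where
  | nil
  | cons (a : Expr) (as : Exprs)
  deriving DecidableEq
end

inductive Stmt where
  | skip
  | assign (id : Ident) (a : Expr)
  | store (κ : Chunk) (mode : Mode) (as : Exprs) (a : Expr)
  | call (id : Option Ident) (a : Expr) (args : Exprs) (sig : Sig)
  | tailcall (a : Expr) (args : Exprs) (sig : Sig)
  | ret (a : Option Expr)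
  | seq (s₁ s₂ : Stmt)
  | ite (ce : CondExpr) (s₁ s₂ : Stmt)
  | loop (s : Stmt)
  | block (s : Stmt)
  | exit (n : ℕ)
  | switch (a : Expr) (tbl : SwitchTable)
  | label (lbl : Label) (s : Stmt)
  | goto (lbl : Label)

structure Func where
  sig : Sig
  params : List Ident
  vars : List Ident
  stacksize : ℕ
  body : Stmt

abbrev Fundef := FunDef Func
abbrev Program := Prog Func

def sigOf : Fundef → Sig
  | .internal F => F.sig
  | .external fe => fe.sig

def evalTest : Test → List Val → Option Bool
  | .comp c, [v₁, v₂] => c.evalVal v₁ v₂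
  | .compimm c n, [v] => c.evalVal v (.int n)
  | .compu c, [v₁, v₂] => c.evalValu v₁ v₂
  | .compuimm c n, [v] => c.evalValu v (.int n)
  | .compf c, [v₁, v₂] => c.evalValf v₁ v₂
  | _, _ => none

def evalOp (G : GEnv Func) (σ : Block) : Op → List Val → Option Val
  | .intconst n, [] => some (.int n)
  | .floatconst f, [] => some (.float f)
  | .addrsymbol id δ, [] => (G.symbol id).map fun b => .ptr b δ
  | .addrstack δ, [] => some (.ptr σ δ)
  | .move, [v] => some v
  | .negint, [.int n] => some (.int (-n))
  | .notbool, [.int n] => some (Val.ofBool (n == 0))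
  | .notbool, [.ptr _ _] => some (Val.ofBool false)
  | .cast8u, [.int n] => some (.int (Word.cast8u n))
  | .cast8s, [.int n] => some (.int (Word.cast8s n))
  | .cast16u, [.int n] => some (.int (Word.cast16u n))
  | .cast16s, [.int n] => some (.int (Word.cast16s n))
  | .add, [.int n₁, .int n₂] => some (.int (n₁ + n₂))
  | .add, [.ptr b δ, .int n] => some (.ptr b (δ + n))
  | .add, [.int n, .ptr b δ] => some (.ptr b (δ + n))
  | .addi n, [.int n₁] => some (.int (n₁ + n))
  | .addi n, [.ptr b δ] => some (.ptr b (δ + n))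
  | .sub, [.int n₁, .int n₂] => some (.int (n₁ - n₂))
  | .sub, [.ptr b δ, .int n] => some (.ptr b (δ - n))
  | .sub, [.ptr b₁ δ₁, .ptr b₂ δ₂] => if b₁ = b₂ then some (.int (δ₁ - δ₂)) else none
  | .subi n, [.int n₁] => some (.int (n - n₁))
  | .mul, [.int n₁, .int n₂] => some (.int (n₁ * n₂))
  | .muli n, [.int n₁] => some (.int (n₁ * n))
  | .div, [.int n₁, .int n₂] => if n₂ = 0 then none else some (.int (n₁.sdiv n₂))
  | .divu, [.int n₁, .int n₂] => if n₂ = 0 then none else some (.int (n₁.udiv n₂))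
  | .and, [.int n₁, .int n₂] => some (.int (n₁ &&& n₂))
  | .andi n, [.int n₁] => some (.int (n₁ &&& n))
  | .or, [.int n₁, .int n₂] => some (.int (n₁ ||| n₂))
  | .ori n, [.int n₁] => some (.int (n₁ ||| n))
  | .xor, [.int n₁, .int n₂] => some (.int (n₁ ^^^ n₂))
  | .xori n, [.int n₁] => some (.int (n₁ ^^^ n))
  | .nand, [.int n₁, .int n₂] => some (.int (~~~(n₁ &&& n₂)))
  | .nor, [.int n₁, .int n₂] => some (.int (~~~(n₁ ||| n₂)))
  | .nxor, [.int n₁, .int n₂] => some (.int (~~~(n₁ ^^^ n₂)))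
  | .shl, [.int n₁, .int n₂] => if n₂.toNat < 32 then some (.int (n₁ <<< n₂.toNat)) else none
  | .shr, [.int n₁, .int n₂] =>
    if n₂.toNat < 32 then some (.int (n₁.sshiftRight n₂.toNat)) else none
  | .shri n, [.int n₁] => if n.toNat < 32 then some (.int (n₁.sshiftRight n.toNat)) else none
  | .shru, [.int n₁, .int n₂] => if n₂.toNat < 32 then some (.int (n₁ >>> n₂.toNat)) else none
  | .rolm n m, [.int n₁] => some (.int (Word.rolm n₁ n m))
  | .negf, [.float f] => some (.float (Float.neg f))
  | .absf, [.float f] => some (.float (Float.abs f))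
  | .addf, [.float f₁, .float f₂] => some (.float (Float.add f₁ f₂))
  | .subf, [.float f₁, .float f₂] => some (.float (Float.sub f₁ f₂))
  | .mulf, [.float f₁, .float f₂] => some (.float (Float.mul f₁ f₂))
  | .divf, [.float f₁, .float f₂] => some (.float (Float.div f₁ f₂))
  | .singleoffloat, [.float f] => some (.float (Fl.single f))
  | .intoffloat, [.float f] => (Fl.toSigned f).map .int
  | .intuoffloat, [.float f] => (Fl.toUnsigned f).map .int
  | .floatofint, [.int n] => some (.float (Fl.ofSigned n))
  | .floatofintu, [.int n] => some (.float (Fl.ofUnsigned n))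
  | .cmp c, vs => (evalTest c vs).map Val.ofBool
  | _, _ => none

def evalMode (G : GEnv Func) (σ : Block) : Mode → List Val → Option Val
  | .indexed n, [.ptr b δ] => some (.ptr b (δ + n))
  | .indexed2, [.ptr b δ, .int n] => some (.ptr b (δ + n))
  | .indexed2, [.int n, .ptr b δ] => some (.ptr b (δ + n))
  | .global id δ, [] => (G.symbol id).map fun b => .ptr b δ
  | .based id δ, [.int n] => (G.symbol id).map fun b => .ptr b (δ + n)
  | .stack δ, [] => some (.ptr σ δ)
  | _, _ => none

mutual
inductive EvalExpr (G : GEnv Func) (σ : Block) (E : Env) (M : Mem) : Expr → Val → Prop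
  | var {id v} : E id = some v → EvalExpr G σ E M (.var id) v
  | op {o as vs v} :
      EvalExprs G σ E M as vs → evalOp G σ o vs = some v → EvalExpr G σ E M (.op o as) v
  | load {κ mode as vs b δ v} :
      EvalExprs G σ E M as vs → evalMode G σ mode vs = some (.ptr b δ) →
      M.load κ b δ = some v → EvalExpr G σ E M (.load κ mode as) v
  | cond_true {ce a₁ a₂ v₁} :
      EvalCond G σ E M ce true → EvalExpr G σ E M a₁ v₁ → EvalExpr G σ E M (.cond ce a₁ a₂) v₁
  | cond_false {ce a₁ a₂ v₂} :
      EvalCond G σ E M ce false → EvalExpr G σ E M a₂ v₂ → EvalExpr G σ E M (.cond ce a₁ a₂) v₂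
inductive EvalCond (G : GEnv Func) (σ : Block) (E : Env) (M : Mem) : CondExpr → Bool → Prop
  | tru : EvalCond G σ E M .tru true
  | fls : EvalCond G σ E M .fls false
  | test {c as vs b} :
      EvalExprs G σ E M as vs → evalTest c vs = some b → EvalCond G σ E M (.test c as) b
  | cond_true {ce₁ ce₂ ce₃ b} :
      EvalCond G σ E M ce₁ true → EvalCond G σ E M ce₂ b →
      EvalCond G σ E M (.cond ce₁ ce₂ ce₃) b
  | cond_false {ce₁ ce₂ ce₃ b} :
      EvalCond G σ E M ce₁ false → EvalCond G σ E M ce₃ b →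
      EvalCond G σ E M (.cond ce₁ ce₂ ce₃) b
inductive EvalExprs (G : GEnv Func) (σ : Block) (E : Env) (M : Mem) : Exprs → List Val → Prop
  | nil : EvalExprs G σ E M .nil []
  | cons {a as v vs} :
      EvalExpr G σ E M a v → EvalExprs G σ E M as vs → EvalExprs G σ E M (.cons a as) (v :: vs)
end

/-- Continuations; `empty` is the initial one. -/
inductive Cont where
  | empty
  | seq (s : Stmt) (k : Cont)
  | endblock (k : Cont)
  | returnto (id : Option Ident) (F : Func) (σ : Block) (E : Env) (k : Cont)

def callcont : Cont → Cont
  | .seq _ k => callcont k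
  | .endblock k => callcont k
  | .empty => .empty
  | .returnto id F σ E k => .returnto id F σ E k

def Cont.isCall : Cont → Prop
  | .empty => True
  | .returnto _ _ _ _ _ => True
  | _ => False

def findlabel (lbl : Label) : Stmt → Cont → Option (Stmt × Cont)
  | .seq s₁ s₂, k =>
    match findlabel lbl s₁ (.seq s₂ k) with
    | some r => some r
    | none => findlabel lbl s₂ k
  | .ite _ s₁ s₂, k =>
    match findlabel lbl s₁ k with
    | some r => some r
    | none => findlabel lbl s₂ k
  | .loop s, k => findlabel lbl s (.seq (.loop s) k)
  | .block s, k => findlabel lbl s (.endblock k)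
  | .label lbl' s, k => if lbl' = lbl then some (s, k) else findlabel lbl s k
  | _, _ => none

inductive State where
  | regular (F : Func) (s : Stmt) (k : Cont) (σ : Block) (E : Env) (M : Mem)
  | call (Fd : Fundef) (args : List Val) (k : Cont) (M : Mem)
  | ret (v : Val) (k : Cont) (M : Mem)

inductive Step (G : GEnv Func) : State → Trace → State → Prop
  | skip_seq {F s k σ E M} :
      Step G (.regular F .skip (.seq s k) σ E M) [] (.regular F s k σ E M)
  | skip_endblock {F k σ E M} :
      Step G (.regular F .skip (.endblock k) σ E M) [] (.regular F .skip k σ E M)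
  | assign {F id a k σ E M v} :
      EvalExpr G σ E M a v →
      Step G (.regular F (.assign id a) k σ E M) [] (.regular F .skip k σ (E.set id v) M)
  | store {F κ mode as a k σ E M vs b δ v M'} :
      EvalExprs G σ E M as vs → evalMode G σ mode vs = some (.ptr b δ) →
      EvalExpr G σ E M a v → M.store κ b δ v = some M' →
      Step G (.regular F (.store κ mode as a) k σ E M) [] (.regular F .skip k σ E M')
  | seq {F s₁ s₂ k σ E M} :
      Step G (.regular F (.seq s₁ s₂) k σ E M) [] (.regular F s₁ (.seq s₂ k) σ E M)
  | ite_true {F ce s₁ s₂ k σ E M} :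
      EvalCond G σ E M ce true →
      Step G (.regular F (.ite ce s₁ s₂) k σ E M) [] (.regular F s₁ k σ E M)
  | ite_false {F ce s₁ s₂ k σ E M} :
      EvalCond G σ E M ce false →
      Step G (.regular F (.ite ce s₁ s₂) k σ E M) [] (.regular F s₂ k σ E M)
  | loop {F s k σ E M} :
      Step G (.regular F (.loop s) k σ E M) [] (.regular F s (.seq (.loop s) k) σ E M)
  | block {F s k σ E M} :
      Step G (.regular F (.block s) k σ E M) [] (.regular F s (.endblock k) σ E M)
  | exit_seq {F n s k σ E M} :
      Step G (.regular F (.exit n) (.seq s k) σ E M) [] (.regular F (.exit n) k σ E M)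
  | exit_zero {F k σ E M} :
      Step G (.regular F (.exit 0) (.endblock k) σ E M) [] (.regular F .skip k σ E M)
  | exit_succ {F n k σ E M} :
      Step G (.regular F (.exit (n + 1)) (.endblock k) σ E M) [] (.regular F (.exit n) k σ E M)
  | switch {F a tbl k σ E M n} :
      EvalExpr G σ E M a (.int n) →
      Step G (.regular F (.switch a tbl) k σ E M) [] (.regular F (.exit (tbl.target n)) k σ E M)
  | label {F lbl s k σ E M} :
      Step G (.regular F (.label lbl s) k σ E M) [] (.regular F s k σ E M)
  | goto {F lbl k σ E M s' k'} :
      findlabel lbl F.body (callcont k) = some (s', k') →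
      Step G (.regular F (.goto lbl) k σ E M) [] (.regular F s' k' σ E M)
  | call {F id a as sig k σ E M b vs Fd} :
      EvalExpr G σ E M a (.ptr b 0) → EvalExprs G σ E M as vs →
      G.funct b = some Fd → sigOf Fd = sig →
      Step G (.regular F (.call id a as sig) k σ E M) [] (.call Fd vs (.returnto id F σ E k) M)
  | tailcall {F a as sig k σ E M b vs Fd} :
      EvalExpr G σ E M a (.ptr b 0) → EvalExprs G σ E M as vs →
      G.funct b = some Fd → sigOf Fd = sig →
      Step G (.regular F (.tailcall a as sig) k σ E M) []
        (.call Fd vs (callcont k) (M.free σ))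
  | skip_call {F k σ E M} :
      F.sig.res = none → k.isCall →
      Step G (.regular F .skip k σ E M) [] (.ret .undef k (M.free σ))
  | ret_none {F k σ E M} :
      F.sig.res = none →
      Step G (.regular F (.ret none) k σ E M) [] (.ret .undef (callcont k) (M.free σ))
  | ret_some {F a k σ E M v} :
      F.sig.res ≠ none → EvalExpr G σ E M a v →
      Step G (.regular F (.ret (some a)) k σ E M) [] (.ret v (callcont k) (M.free σ))
  | internal {F vs k M σ M'} :
      M.alloc 0 F.stacksize = (σ, M') →
      Step G (.call (.internal F) vs k M) []
        (.regular F F.body k σ (Env.entry F.params F.vars vs) M')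
  | external {fe vs k M t v} :
      ExtCall fe vs t v → Step G (.call (.external fe) vs k M) t (.ret v k M)
  | ret {v id F σ E k M} :
      Step G (.ret v (.returnto id F σ E k) M) [] (.regular F .skip k σ (E.setOpt id v) M)

inductive Initial (P : Program) : State → Prop
  | intro {b Fd} :
      P.globalEnv.symbol P.main = some b → P.globalEnv.funct b = some Fd →
      Initial P (.call Fd [] .empty P.initMem)

inductive Final : State → Word → Prop
  | intro {n M} : Final (.ret (.int n) .empty M) n

def Exec (P : Program) : Behavior → Prop :=
  Behaves (Step P.globalEnv) (Initial P) Final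

/-- Operator application to zero, one or two arguments. -/
abbrev op₀ (o : Op) : Expr := .op o .nil
abbrev op₁ (o : Op) (a : Expr) : Expr := .op o (.cons a .nil)
abbrev op₂ (o : Op) (a₁ a₂ : Expr) : Expr := .op o (.cons a₁ (.cons a₂ .nil))

end CminorSel

/-! ## Instruction selection -/

namespace Selection

open CminorSel

/-! ### Smart constructors -/

def addi (n : Word) : Expr → Expr
  | .op (.intconst m) .nil => op₀ (.intconst (n + m))
  | .op (.addi m) (.cons a .nil) => op₁ (.addi (n + m)) a
  | .op (.addrsymbol id δ) .nil => op₀ (.addrsymbol id (δ + n))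
  | .op (.addrstack δ) .nil => op₀ (.addrstack (δ + n))
  | a => op₁ (.addi n) a

/-- Constant operands come first, so that `8 + (x + 1) * 4` becomes `x * 4 + 12`. -/
def add : Expr → Expr → Expr
  | .op (.intconst n) .nil, a => addi n a
  | a, .op (.intconst n) .nil => addi n a
  | .op (.addi n₁) (.cons a₁ .nil), .op (.addi n₂) (.cons a₂ .nil) =>
    addi (n₁ + n₂) (op₂ .add a₁ a₂)
  | .op (.addi n) (.cons a₁ .nil), a₂ => addi n (op₂ .add a₁ a₂)
  | a₁, .op (.addi n) (.cons a₂ .nil) => addi n (op₂ .add a₁ a₂)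
  | a₁, a₂ => op₂ .add a₁ a₂

def sub : Expr → Expr → Expr
  | a, .op (.intconst n) .nil => addi (-n) a
  | .op (.intconst n) .nil, a => op₁ (.subi n) a
  | .op (.addi n₁) (.cons a₁ .nil), .op (.addi n₂) (.cons a₂ .nil) =>
    addi (n₁ - n₂) (op₂ .sub a₁ a₂)
  | .op (.addi n) (.cons a₁ .nil), a₂ => addi n (op₂ .sub a₁ a₂)
  | a₁, .op (.addi n) (.cons a₂ .nil) => addi (-n) (op₂ .sub a₁ a₂)
  | a₁, a₂ => op₂ .sub a₁ a₂

def muli (m : Word) : Expr → Expr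
  | .op (.intconst n) .nil => op₀ (.intconst (m * n))
  | .op (.addi n) (.cons a .nil) => addi (m * n) (op₁ (.muli m) a)
  | a => op₁ (.muli m) a

def mul : Expr → Expr → Expr
  | .op (.intconst n) .nil, a => muli n a
  | a, .op (.intconst n) .nil => muli n a
  | a₁, a₂ => op₂ .mul a₁ a₂

def rolm (n m : Word) : Expr → Expr
  | .op (.intconst x) .nil => op₀ (.intconst (Word.rolm x n m))
  | .op (.rolm n' m') (.cons a .nil) => op₁ (.rolm (n' + n) (Word.rol m' n &&& m)) a
  | a => op₁ (.rolm n m) a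

def shl : Expr → Expr → Expr
  | a, .op (.intconst n) .nil => rolm n ((-1 : Word) <<< n.toNat) a
  | a₁, a₂ => op₂ .shl a₁ a₂

def shru : Expr → Expr → Expr
  | a, .op (.intconst n) .nil => rolm (32 - n) ((-1 : Word) >>> n.toNat) a
  | a₁, a₂ => op₂ .shru a₁ a₂

def shr : Expr → Expr → Expr
  | a, .op (.intconst n) .nil => op₁ (.shri n) a
  | a₁, a₂ => op₂ .shr a₁ a₂

def and : Expr → Expr → Expr
  | .op (.intconst n) .nil, a => rolm 0 n a
  | a, .op (.intconst n) .nil => rolm 0 n a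
  | a₁, a₂ => op₂ .and a₁ a₂

def or : Expr → Expr → Expr
  | .op (.intconst n) .nil, a => op₁ (.ori n) a
  | a, .op (.intconst n) .nil => op₁ (.ori n) a
  | .op (.rolm n₁ m₁) (.cons a₁ .nil), .op (.rolm n₂ m₂) (.cons a₂ .nil) =>
    if n₁ = n₂ ∧ a₁ = a₂ then op₁ (.rolm n₁ (m₁ ||| m₂)) a₁
    else op₂ .or (op₁ (.rolm n₁ m₁) a₁) (op₁ (.rolm n₂ m₂) a₂)
  | a₁, a₂ => op₂ .or a₁ a₂

def xor : Expr → Expr → Expr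
  | .op (.intconst n) .nil, a => op₁ (.xori n) a
  | a, .op (.intconst n) .nil => op₁ (.xori n) a
  | a₁, a₂ => op₂ .xor a₁ a₂

/-- The remainder, synthesized from a division `d`. -/
def modAux (d : Op) (a₁ a₂ : Expr) : Expr :=
  op₂ .sub a₁ (op₂ .mul (op₂ d a₁ a₂) a₂)

def comp (c : Cmp) : Expr → Expr → Expr
  | .op (.intconst n) .nil, a => op₁ (.cmp (.compimm c.swap n)) a
  | a, .op (.intconst n) .nil => op₁ (.cmp (.compimm c n)) a
  | a₁, a₂ => op₂ (.cmp (.comp c)) a₁ a₂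

def compu (c : Cmp) : Expr → Expr → Expr
  | .op (.intconst n) .nil, a => op₁ (.cmp (.compuimm c.swap n)) a
  | a, .op (.intconst n) .nil => op₁ (.cmp (.compuimm c n)) a
  | a₁, a₂ => op₂ (.cmp (.compu c)) a₁ a₂

def notint : Expr → Expr
  | .op .and (.cons a₁ (.cons a₂ .nil)) => op₂ .nand a₁ a₂
  | .op .or (.cons a₁ (.cons a₂ .nil)) => op₂ .nor a₁ a₂
  | .op .xor (.cons a₁ (.cons a₂ .nil)) => op₂ .nxor a₁ a₂
  | a => op₂ .nor a a

/-- Negation of a test. Orderings of floats have no negation, because of NaN. -/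
def negTest : Test → Option Test
  | .comp c => some (.comp c.negate)
  | .compimm c n => some (.compimm c.negate n)
  | .compu c => some (.compu c.negate)
  | .compuimm c n => some (.compuimm c.negate n)
  | .compf .eq => some (.compf .ne)
  | .compf .ne => some (.compf .eq)
  | .compf _ => none

def notbool : Expr → Expr
  | .op (.intconst n) .nil => op₀ (.intconst (if n = 0 then 1 else 0))
  | .op (.cmp c) as =>
    match negTest c with
    | some c' => .op (.cmp c') as
    | none => op₁ .notbool (.op (.cmp c) as)
  | .cond ce a₁ a₂ => .cond ce (notbool a₁) (notbool a₂)
  | a => op₁ .notbool a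

def negCond : CondExpr → CondExpr
  | .tru => .fls
  | .fls => .tru
  | .test c as =>
    match negTest c with
    | some c' => .test c' as
    | none => .cond (.test c as) .fls .tru
  | .cond ce₁ ce₂ ce₃ => .cond ce₁ (negCond ce₂) (negCond ce₃)

/-- Recognition of conditions. -/
def cond : Expr → CondExpr
  | .op (.intconst n) .nil => if n = 0 then .fls else .tru
  | .op .notbool (.cons a .nil) => negCond (cond a)
  | .op (.cmp c) as => .test c as
  | .cond ce a₁ a₂ => .cond ce (cond a₁) (cond a₂)
  | a => .test (.compimm .ne 0) (.cons a .nil)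

/-- Recognition of addressing modes. -/
def mode : Expr → Mode × Exprs
  | .op (.addrsymbol id δ) .nil => (.global id δ, .nil)
  | .op (.addrstack δ) .nil => (.stack δ, .nil)
  | .op .add (.cons (.op (.addrsymbol id δ) .nil) (.cons a .nil)) => (.based id δ, .cons a .nil)
  | .op (.addi n) (.cons a .nil) => (.indexed n, .cons a .nil)
  | .op .add (.cons a₁ (.cons a₂ .nil)) => (.indexed2, .cons a₁ (.cons a₂ .nil))
  | a => (.indexed 0, .cons a .nil)

def const : Cminor.Const → Expr
  | .int n => op₀ (.intconst n)
  | .float f => op₀ (.floatconst f)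
  | .addrsymbol id => op₀ (.addrsymbol id 0)
  | .addrstack δ => op₀ (.addrstack δ)

def unop : Cminor.Unop → Expr → Expr
  | .negint => op₁ .negint
  | .notint => notint
  | .notbool => notbool
  | .negf => op₁ .negf
  | .absf => op₁ .absf
  | .cast8u => op₁ .cast8u
  | .cast8s => op₁ .cast8s
  | .cast16u => op₁ .cast16u
  | .cast16s => op₁ .cast16s
  | .singleoffloat => op₁ .singleoffloat
  | .intoffloat => op₁ .intoffloat
  | .intuoffloat => op₁ .intuoffloat
  | .floatofint => op₁ .floatofint
  | .floatofintu => op₁ .floatofintu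

def binop : Cminor.Binop → Expr → Expr → Expr
  | .add => add
  | .sub => sub
  | .mul => mul
  | .div => op₂ .div
  | .divu => op₂ .divu
  | .mod => modAux .div
  | .modu => modAux .divu
  | .and => and
  | .or => or
  | .xor => xor
  | .shl => shl
  | .shr => shr
  | .shru => shru
  | .addf => op₂ .addf
  | .subf => op₂ .subf
  | .mulf => op₂ .mulf
  | .divf => op₂ .divf
  | .cmp c => comp c
  | .cmpu c => compu c
  | .cmpf c => op₂ (.cmp (.compf c))

/-! ### Translation of expressions, statements, functions, programs -/

def expr : Cminor.Expr → Expr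
  | .var id => .var id
  | .const c => const c
  | .unop op a => unop op (expr a)
  | .binop op a₁ a₂ => binop op (expr a₁) (expr a₂)
  | .load κ a => .load κ (mode (expr a)).1 (mode (expr a)).2
  | .cond a₁ a₂ a₃ => .cond (cond (expr a₁)) (expr a₂) (expr a₃)

def exprs : List Cminor.Expr → Exprs
  | [] => .nil
  | a :: as => .cons (expr a) (exprs as)

def stmt : Cminor.Stmt → Stmt
  | .skip => .skip
  | .assign id a => .assign id (expr a)
  | .store κ a₁ a₂ => .store κ (mode (expr a₁)).1 (mode (expr a₁)).2 (expr a₂)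
  | .call id a as sig => .call id (expr a) (exprs as) sig
  | .tailcall a as sig => .tailcall (expr a) (exprs as) sig
  | .ret none => .ret none
  | .ret (some a) => .ret (some (expr a))
  | .seq s₁ s₂ => .seq (stmt s₁) (stmt s₂)
  | .ite a s₁ s₂ => .ite (cond (expr a)) (stmt s₁) (stmt s₂)
  | .loop s => .loop (stmt s)
  | .block s => .block (stmt s)
  | .exit n => .exit n
  | .switch a tbl => .switch (expr a) tbl
  | .label lbl s => .label lbl (stmt s)
  | .goto lbl => .goto lbl

def func (F : Cminor.Func) : Func where
  sig := F.sig
  params := F.params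
  vars := F.vars
  stacksize := F.stacksize
  body := stmt F.body

def fundef : Cminor.Fundef → Fundef := FunDef.map func

def program : Cminor.Program → Program := Prog.map func

def cont : Cminor.Cont → Cont
  | .empty => .empty
  | .seq s k => .seq (stmt s) (cont k)
  | .endblock k => .endblock (cont k)
  | .returnto id F σ E k => .returnto id (func F) σ E (cont k)

/-- The relation between Cminor and CminorSel execution states. -/
inductive Match : Cminor.State → State → Prop
  | regular {F s k σ E M} :
      Match (.regular F s k σ E M) (.regular (func F) (stmt s) (cont k) σ E M)
  | call {Fd vs k M} : Match (.call Fd vs k M) (.call (fundef Fd) vs (cont k) M)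
  | ret {v k M} : Match (.ret v k M) (.ret v (cont k) M)

end Selection

end BackEnd

-- Selection changes only the shape of expressions. Both languages share values, memory states and
-- local environments, and every statement keeps its structure, so simulation reduces to showing
-- that the selected expression computes the same value.
--
-- At the bottom this is algebra. Immediate folding and reassociation are ring identities modulo
-- 2^32, valid also for pointer offsets. Shifts by constants and masks become rotate-and-mask
-- operations, which compose (`Word.rolm_rolm`), and remainders come from the Euclidean identity for
-- division. Fusing two masks of the same rotated expression also needs determinism of evaluation
-- (`EvalExpr.deterministic`). Conditions rest on the complement of tests (`evalTest_negTest`),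
-- which for floats is available only for equality and disequality because of NaN. Addressing modes
-- use that a sum whose value is a pointer has exactly one pointer operand.
--
-- These facts hold in any global environment. To move from Cminor to CminorSel it remains to see
-- that translation keeps the names and the order of globals, hence their blocks. Induction on
-- Cminor derivations then gives `evalExpr_expr`, each transition is answered by its namesake
-- (`step_simulation`), and a generic argument on lock-step simulations carries finite and infinite
-- executions across.

namespace BackEnd

-- Inversion and determinism of CminorSel evaluation.

namespace CminorSel

variable {G : GEnv Func} {σ : Block} {E : Env} {M : Mem}

@[simp] theorem evalExprs_nil_iff {vs : List Val} : EvalExprs G σ E M .nil vs ↔ vs = [] := by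
  constructor
  · rintro ⟨⟩; rfl
  · rintro rfl; exact .nil

theorem evalExprs_cons_iff {a : Expr} {as : Exprs} {vs : List Val} :
    EvalExprs G σ E M (.cons a as) vs ↔
      ∃ v ws, vs = v :: ws ∧ EvalExpr G σ E M a v ∧ EvalExprs G σ E M as ws := by
  constructor
  · rintro (_ | ⟨h, h'⟩); exact ⟨_, _, rfl, h, h'⟩
  · rintro ⟨v, ws, rfl, h, h'⟩; exact .cons h h'

theorem evalExpr_op_iff {o : Op} {as : Exprs} {v : Val} :
    EvalExpr G σ E M (.op o as) v ↔
      ∃ vs, EvalExprs G σ E M as vs ∧ evalOp G σ o vs = some v := by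
  constructor
  · rintro (_ | ⟨h, h'⟩); exact ⟨_, h, h'⟩
  · rintro ⟨vs, h, h'⟩; exact .op h h'

@[simp] theorem evalExpr_op₀_iff {o : Op} {v : Val} :
    EvalExpr G σ E M (.op o .nil) v ↔ evalOp G σ o [] = some v := by
  simp [evalExpr_op_iff]

@[simp] theorem evalExpr_op₁_iff {o : Op} {a : Expr} {v : Val} :
    EvalExpr G σ E M (.op o (.cons a .nil)) v ↔
      ∃ w, EvalExpr G σ E M a w ∧ evalOp G σ o [w] = some v := by
  simp [evalExpr_op_iff, evalExprs_cons_iff]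

@[simp] theorem evalExpr_op₂_iff {o : Op} {a₁ a₂ : Expr} {v : Val} :
    EvalExpr G σ E M (.op o (.cons a₁ (.cons a₂ .nil))) v ↔
      ∃ v₁ v₂, EvalExpr G σ E M a₁ v₁ ∧ EvalExpr G σ E M a₂ v₂ ∧
        evalOp G σ o [v₁, v₂] = some v := by
  simp only [evalExpr_op_iff, evalExprs_cons_iff, evalExprs_nil_iff]
  grind

/-- Operators, tests, modes and loads are partial functions, and the two rules for a conditional
exclude each other once its condition is deterministic. It serves the fusion of two masks in `or`.
-/
theorem EvalExpr.deterministic {a : Expr} {v w : Val} (h : EvalExpr G σ E M a v)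
    (h' : EvalExpr G σ E M a w) : v = w := by
  -- The three judgments are mutually inductive, so determinism is proved for all of them at once,
  -- with the second result quantified inside each motive.
  refine EvalExpr.rec (G := G) (σ := σ) (E := E) (M := M)
    (motive_1 := fun a v _ => ∀ w, EvalExpr G σ E M a w → v = w)
    (motive_2 := fun ce b _ => ∀ c, EvalCond G σ E M ce c → b = c)
    (motive_3 := fun as vs _ => ∀ ws, EvalExprs G σ E M as ws → vs = ws)
    ?_ ?_ ?_ ?_ ?_ ?_ ?_ ?_ ?_ ?_ ?_ ?_ h w h'
  all_goals intros
  all_goals rename_i hw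
  all_goals cases hw <;> grind

end CminorSel

-- Comparisons under exchange of operands and negation.

namespace Cmp

theorem evalInt_swap (c : Cmp) (x y : Word) : c.swap.evalInt x y = c.evalInt y x := by
  cases c <;> simp [swap, evalInt, Bool.beq_comm, bne]

theorem evalIntu_swap (c : Cmp) (x y : Word) : c.swap.evalIntu x y = c.evalIntu y x := by
  cases c <;> simp [swap, evalIntu, Bool.beq_comm, bne]

theorem evalInt_negate (c : Cmp) (x y : Word) : c.negate.evalInt x y = !c.evalInt x y := by
  cases c <;> simp [negate, evalInt, bne, BitVec.slt, BitVec.sle] <;> grind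

theorem evalIntu_negate (c : Cmp) (x y : Word) : c.negate.evalIntu x y = !c.evalIntu x y := by
  cases c <;> simp [negate, evalIntu, bne, BitVec.ult, BitVec.ule] <;> grind

theorem evalMismatch_negate (c : Cmp) :
    c.negate.evalMismatch = c.evalMismatch.map (!·) := by
  cases c <;> rfl

theorem evalMismatch_swap (c : Cmp) : c.swap.evalMismatch = c.evalMismatch := by
  cases c <;> rfl

theorem evalNull_negate (c : Cmp) (n : Word) : c.negate.evalNull n = (c.evalNull n).map (!·) := by
  unfold evalNull; split <;> simp [evalMismatch_negate]

/-- The machine order is total, and for pointers into distinct blocks or against null only `eq` and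
`ne` are defined, and they are opposite. As an equality of options it also says that negation
preserves undefinedness. -/
theorem evalVal_negate (c : Cmp) (v w : Val) :
    c.negate.evalVal v w = (c.evalVal v w).map (!·) := by
  cases v <;> cases w <;> simp [evalVal, evalInt_negate, evalNull_negate]
  split <;> simp [evalMismatch_negate]

theorem evalValu_negate (c : Cmp) (v w : Val) :
    c.negate.evalValu v w = (c.evalValu v w).map (!·) := by
  cases v <;> cases w <;> simp [evalValu, evalIntu_negate]

/-- The case needed when a constant left operand becomes the immediate of a test. -/
theorem evalVal_swap_int (c : Cmp) (v : Val) (n : Word) :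
    c.swap.evalVal v (.int n) = c.evalVal (.int n) v := by
  cases v <;> simp [evalVal, evalInt_swap, evalNull, evalMismatch_swap]

theorem evalValu_swap_int (c : Cmp) (v : Val) (n : Word) :
    c.swap.evalValu v (.int n) = c.evalValu (.int n) v := by
  cases v <;> simp [evalValu, evalIntu_swap]

end Cmp

-- Rotate-and-mask identities and remainders on machine words.

namespace Word

/-- The source index is `i - n` modulo 32; adding 32 and reducing `n` first keep the natural
subtraction from truncating. -/
theorem getElem_rol (x n : Word) (i : ℕ) (hi : i < 32) :
    (rol x n)[i] = x.getLsbD ((i + 32 - n.toNat % 32) % 32) := by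
  unfold rol
  rw [BitVec.getElem_rotateLeft]
  split <;> rw [← BitVec.getLsbD_eq_getElem] <;> congr 1 <;> omega

theorem getLsbD_rol (x n : Word) (i : ℕ) (hi : i < 32) :
    (rol x n).getLsbD i = x.getLsbD ((i + 32 - n.toNat % 32) % 32) := by
  rw [BitVec.getLsbD_eq_getElem hi, getElem_rol x n i hi]

/-- Rotation distributes over bitwise conjunction, and amounts add up; the wrap-around of `n₁ + n₂`
is harmless because 32 divides 2^32. -/
theorem rolm_rolm (x n₁ m₁ n₂ m₂ : Word) :
    rolm (rolm x n₁ m₁) n₂ m₂ = rolm x (n₁ + n₂) (rol m₁ n₂ &&& m₂) := by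
  unfold rolm
  ext i hi
  rw [BitVec.getElem_and, getElem_rol _ _ _ hi, BitVec.getLsbD_and,
    getLsbD_rol _ _ _ (Nat.mod_lt _ (by norm_num)), BitVec.getElem_and, BitVec.getElem_and,
    getElem_rol _ _ _ hi, getElem_rol _ _ _ hi, Bool.and_assoc, BitVec.toNat_add]
  congr 2
  omega

theorem rolm_or (x n m₁ m₂ : Word) : rolm x n m₁ ||| rolm x n m₂ = rolm x n (m₁ ||| m₂) :=
  BitVec.and_or_distrib_left.symm

theorem rolm_zero (x m : Word) : rolm x 0 m = x &&& m := by
  unfold rolm rol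
  ext i hi
  simp [BitVec.getElem_rotateLeft]

/-- A shift is a rotation whose wrapped-around bits, here the `n` lowest, are masked off. -/
theorem shiftLeft_eq_rolm (x n : Word) (hn : n.toNat < 32) :
    x <<< n.toNat = rolm x n ((-1 : Word) <<< n.toNat) := by
  unfold rolm
  ext i hi
  rw [BitVec.getElem_and, getElem_rol _ _ _ hi]
  simp only [BitVec.getElem_shiftLeft, show (-1 : Word) = BitVec.allOnes 32 from rfl, BitVec.getElem_allOnes]
  by_cases h : i < n.toNat
  · simp [h]
  · simp only [h, decide_false, Bool.not_false, Bool.true_and, Bool.and_true]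
    rw [← BitVec.getLsbD_eq_getElem]
    congr 1
    omega

theorem ushiftRight_eq_rolm (x n : Word) (hn : n.toNat < 32) :
    x >>> n.toNat = rolm x (32 - n) ((-1 : Word) >>> n.toNat) := by
  -- A right shift is a left rotation by `32 - n`. The equation is taken modulo 32 because `n = 0`
  -- gives the amount 32, that is, no rotation.
  have h32 : (32 - n).toNat % 32 = (32 - n.toNat) % 32 := by
    rw [BitVec.toNat_sub]; simp; omega
  unfold rolm
  ext i hi
  rw [BitVec.getElem_and, getElem_rol _ _ _ hi, h32]
  simp only [BitVec.getElem_ushiftRight, show (-1 : Word) = BitVec.allOnes 32 from rfl,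
    BitVec.getLsbD_allOnes]
  by_cases h : n.toNat + i < 32
  · simp only [h, decide_true, Bool.and_true]
    congr 1
    omega
  · simp [h, BitVec.getLsbD_of_ge x (n.toNat + i) (by omega)]

/-- The identity of truncated division in ℤ, reduced modulo 2^32. The reduction also absorbs the
overflowing quotient of -2^31 by -1. -/
theorem sub_sdiv_mul (x y : Word) : x - x.sdiv y * y = x.srem y := by
  have hd : x.sdiv y = BitVec.ofInt 32 (x.toInt.tdiv y.toInt) :=
    BitVec.eq_of_toInt_eq (by rw [BitVec.toInt_sdiv, BitVec.toInt_ofInt])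
  have hm : x.srem y = BitVec.ofInt 32 (x.toInt.tmod y.toInt) := by
    rw [← BitVec.toInt_srem, BitVec.ofInt_toInt]
  have hx := congrArg (BitVec.ofInt 32) (Int.mul_tdiv_add_tmod x.toInt y.toInt)
  rw [BitVec.ofInt_add, BitVec.ofInt_mul, BitVec.ofInt_toInt, BitVec.ofInt_toInt, ← hd, ← hm] at hx
  rw [BitVec.mul_comm]
  nth_rewrite 1 [← hx]
  rw [BitVec.add_comm, BitVec.add_sub_cancel]

theorem sub_udiv_mul (x y : Word) : x - x.udiv y * y = x.umod y := by
  have hd : x / y = BitVec.ofNat 32 (x.toNat / y.toNat) := by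
    rw [← BitVec.toNat_udiv, BitVec.ofNat_toNat, BitVec.setWidth_eq]
  have hm : x % y = BitVec.ofNat 32 (x.toNat % y.toNat) := by
    rw [← BitVec.toNat_umod, BitVec.ofNat_toNat, BitVec.setWidth_eq]
  have hx := congrArg (BitVec.ofNat 32) (Nat.div_add_mod x.toNat y.toNat)
  rw [BitVec.ofNat_add, BitVec.ofNat_mul, BitVec.ofNat_toNat, BitVec.ofNat_toNat,
    BitVec.setWidth_eq, BitVec.setWidth_eq, ← hd, ← hm] at hx
  rw [BitVec.udiv_eq, BitVec.umod_eq, BitVec.mul_comm]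
  nth_rewrite 1 [← hx]
  rw [BitVec.add_comm, BitVec.add_sub_cancel]

end Word

open CminorSel

namespace Selection

-- Smart constructors for addition, subtraction and multiplication.

section
variable {G : GEnv Func} {σ : Block} {E : Env} {M : Mem}

/-- Phrasing the hypothesis through `evalOp` treats integers and pointers together: each fold is
associativity or commutativity of word addition. The constructors that float a constant outward end
with this one. -/
theorem evalExpr_addi {a : Expr} {w v : Val} (n : Word) (ha : EvalExpr G σ E M a w)
    (hv : evalOp G σ (.addi n) [w] = some v) : EvalExpr G σ E M (addi n a) v := by
  unfold addi
  split
  · simp only [evalExpr_op₀_iff, evalOp, Option.some.injEq] at ha ⊢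
    subst ha
    simpa [evalOp, BitVec.add_comm] using hv
  · simp at ha ⊢
    obtain ⟨u, hu, huw⟩ := ha
    refine ⟨u, hu, ?_⟩
    cases u <;> simp [evalOp] at huw <;> subst huw <;> rw [← hv] <;> simp [evalOp] <;> ac_rfl
  · simp [evalOp] at ha ⊢
    obtain ⟨b, hb, rfl⟩ := ha
    simpa [hb, evalOp] using hv
  · simp [evalOp] at ha ⊢
    subst ha
    simpa [evalOp] using hv
  · exact .op (.cons ha .nil) hv

theorem evalExpr_add {a₁ a₂ : Expr} {v₁ v₂ v : Val} (h₁ : EvalExpr G σ E M a₁ v₁)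
    (h₂ : EvalExpr G σ E M a₂ v₂) (hv : evalOp G σ .add [v₁, v₂] = some v) :
    EvalExpr G σ E M (add a₁ a₂) v := by
  unfold add
  split
  · simp [evalOp] at h₁
    subst h₁
    refine evalExpr_addi _ h₂ ?_
    cases v₂ <;> simp_all [evalOp, BitVec.add_comm]
  · simp [evalOp] at h₂
    subst h₂
    refine evalExpr_addi _ h₁ ?_
    cases v₁ <;> simp_all [evalOp]
  · simp at h₁ h₂
    obtain ⟨w₁, h₁, e₁⟩ := h₁
    obtain ⟨w₂, h₂, e₂⟩ := h₂
    cases w₁ <;> simp [evalOp] at e₁ <;> cases w₂ <;> simp [evalOp] at e₂ <;> subst e₁ e₂ <;>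
      simp [evalOp] at hv <;> subst hv
    all_goals refine evalExpr_addi _ (.op (.cons h₁ (.cons h₂ .nil)) rfl) ?_
    all_goals simp [evalOp]; ac_rfl
  · simp at h₁
    obtain ⟨w₁, h₁, e₁⟩ := h₁
    cases w₁ <;> simp [evalOp] at e₁ <;> subst e₁ <;> cases v₂ <;>
      simp [evalOp] at hv <;> subst hv
    all_goals refine evalExpr_addi _ (.op (.cons h₁ (.cons h₂ .nil)) rfl) ?_
    all_goals simp [evalOp]; ac_rfl
  · simp at h₂
    obtain ⟨w₂, h₂, e₂⟩ := h₂
    cases w₂ <;> simp [evalOp] at e₂ <;> subst e₂ <;> cases v₁ <;>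
      simp [evalOp] at hv <;> subst hv
    all_goals refine evalExpr_addi _ (.op (.cons h₁ (.cons h₂ .nil)) rfl) ?_
    all_goals simp [evalOp]; try ac_rfl
  · exact .op (.cons h₁ (.cons h₂ .nil)) hv

theorem evalExpr_sub {a₁ a₂ : Expr} {v₁ v₂ v : Val} (h₁ : EvalExpr G σ E M a₁ v₁)
    (h₂ : EvalExpr G σ E M a₂ v₂) (hv : evalOp G σ .sub [v₁, v₂] = some v) :
    EvalExpr G σ E M (sub a₁ a₂) v := by
  unfold sub
  split
  · simp [evalOp] at h₂
    subst h₂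
    refine evalExpr_addi _ h₁ ?_
    cases v₁ <;> simp_all [evalOp, BitVec.sub_eq_add_neg]
  · simp [evalOp] at h₁
    subst h₁
    refine .op (.cons h₂ .nil) ?_
    cases v₂ <;> simp_all [evalOp]
  · simp at h₁ h₂
    obtain ⟨w₁, h₁, e₁⟩ := h₁
    obtain ⟨w₂, h₂, e₂⟩ := h₂
    cases w₁ <;> simp [evalOp] at e₁ <;> cases w₂ <;> simp [evalOp] at e₂ <;> subst e₁ e₂ <;>
      simp [evalOp] at hv
    · subst hv
      refine evalExpr_addi _ (.op (.cons h₁ (.cons h₂ .nil)) rfl) ?_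
      simp [evalOp]; ring
    · subst hv
      refine evalExpr_addi _ (.op (.cons h₁ (.cons h₂ .nil)) rfl) ?_
      simp [evalOp]; ring
    -- Difference of two pointers: displacing them does not change their blocks, so the equality of
    -- blocks also justifies the inner subtraction.
    · obtain ⟨hb, rfl⟩ := hv
      refine evalExpr_addi _ (.op (.cons h₁ (.cons h₂ .nil)) (if_pos hb)) ?_
      simp [evalOp]; ring
  · simp at h₁
    obtain ⟨w₁, h₁, e₁⟩ := h₁
    cases w₁ <;> simp [evalOp] at e₁ <;> subst e₁ <;> cases v₂ <;>
      simp [evalOp] at hv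
    · subst hv
      refine evalExpr_addi _ (.op (.cons h₁ (.cons h₂ .nil)) rfl) ?_
      simp [evalOp]; ring
    · subst hv
      refine evalExpr_addi _ (.op (.cons h₁ (.cons h₂ .nil)) rfl) ?_
      simp [evalOp]; ring
    · obtain ⟨hb, rfl⟩ := hv
      refine evalExpr_addi _ (.op (.cons h₁ (.cons h₂ .nil)) (if_pos hb)) ?_
      simp [evalOp]; ring
  · simp at h₂
    obtain ⟨w₂, h₂, e₂⟩ := h₂
    cases w₂ <;> simp [evalOp] at e₂ <;> subst e₂ <;> cases v₁ <;>
      simp [evalOp] at hv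
    · subst hv
      refine evalExpr_addi _ (.op (.cons h₁ (.cons h₂ .nil)) rfl) ?_
      simp [evalOp]; ring
    · subst hv
      refine evalExpr_addi _ (.op (.cons h₁ (.cons h₂ .nil)) rfl) ?_
      simp [evalOp]; ring
    · obtain ⟨hb, rfl⟩ := hv
      refine evalExpr_addi _ (.op (.cons h₁ (.cons h₂ .nil)) (if_pos hb)) ?_
      simp [evalOp]; ring
  · exact .op (.cons h₁ (.cons h₂ .nil)) hv

theorem evalExpr_muli {a : Expr} (m : Word) {n : Word} (ha : EvalExpr G σ E M a (.int n)) :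
    EvalExpr G σ E M (muli m a) (.int (n * m)) := by
  unfold muli
  split
  · simp_all [evalOp, BitVec.mul_comm]
  · simp at ha
    obtain ⟨w, h, e⟩ := ha
    -- A displaced pointer is still a pointer, so an integer sum forces an integer operand;
    -- distributivity then applies.
    cases w <;> simp [evalOp] at e
    subst e
    refine evalExpr_addi _ (.op (.cons h .nil) rfl) ?_
    simp [evalOp]; ring
  · exact .op (.cons ha .nil) rfl

theorem evalExpr_mul {a₁ a₂ : Expr} {n₁ n₂ : Word} (h₁ : EvalExpr G σ E M a₁ (.int n₁))
    (h₂ : EvalExpr G σ E M a₂ (.int n₂)) :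
    EvalExpr G σ E M (mul a₁ a₂) (.int (n₁ * n₂)) := by
  unfold mul
  split
  · simp [evalOp] at h₁
    subst h₁
    rw [BitVec.mul_comm]
    exact evalExpr_muli _ h₂
  · simp [evalOp] at h₂
    subst h₂
    exact evalExpr_muli _ h₁
  · exact .op (.cons h₁ (.cons h₂ .nil)) rfl

-- Rotations, shifts, bitwise operators and remainders.

theorem evalExpr_rolm {a : Expr} (n m : Word) {x : Word} (ha : EvalExpr G σ E M a (.int x)) :
    EvalExpr G σ E M (rolm n m a) (.int (Word.rolm x n m)) := by
  unfold rolm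
  split
  · simp_all [evalOp]
  · simp at ha
    obtain ⟨w, h, e⟩ := ha
    cases w <;> simp [evalOp] at e
    subst e
    rw [Word.rolm_rolm]
    exact .op (.cons h .nil) rfl
  · exact .op (.cons ha .nil) rfl

theorem evalExpr_shl {a₁ a₂ : Expr} {n₁ n₂ : Word} (h₁ : EvalExpr G σ E M a₁ (.int n₁))
    (h₂ : EvalExpr G σ E M a₂ (.int n₂)) (hn : n₂.toNat < 32) :
    EvalExpr G σ E M (shl a₁ a₂) (.int (n₁ <<< n₂.toNat)) := by
  unfold shl
  split
  · simp [evalOp] at h₂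
    subst h₂
    exact Word.shiftLeft_eq_rolm n₁ _ hn ▸ evalExpr_rolm _ _ h₁
  · exact .op (.cons h₁ (.cons h₂ .nil)) (if_pos hn)

theorem evalExpr_shru {a₁ a₂ : Expr} {n₁ n₂ : Word} (h₁ : EvalExpr G σ E M a₁ (.int n₁))
    (h₂ : EvalExpr G σ E M a₂ (.int n₂)) (hn : n₂.toNat < 32) :
    EvalExpr G σ E M (shru a₁ a₂) (.int (n₁ >>> n₂.toNat)) := by
  unfold shru
  split
  · simp [evalOp] at h₂
    subst h₂
    exact Word.ushiftRight_eq_rolm n₁ _ hn ▸ evalExpr_rolm _ _ h₁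
  · exact .op (.cons h₁ (.cons h₂ .nil)) (if_pos hn)

theorem evalExpr_shr {a₁ a₂ : Expr} {n₁ n₂ : Word} (h₁ : EvalExpr G σ E M a₁ (.int n₁))
    (h₂ : EvalExpr G σ E M a₂ (.int n₂)) (hn : n₂.toNat < 32) :
    EvalExpr G σ E M (shr a₁ a₂) (.int (n₁.sshiftRight n₂.toNat)) := by
  unfold shr
  split
  · simp [evalOp] at h₂
    subst h₂
    exact .op (.cons h₁ .nil) (if_pos hn)
  · exact .op (.cons h₁ (.cons h₂ .nil)) (if_pos hn)

theorem evalExpr_and {a₁ a₂ : Expr} {n₁ n₂ : Word} (h₁ : EvalExpr G σ E M a₁ (.int n₁))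
    (h₂ : EvalExpr G σ E M a₂ (.int n₂)) :
    EvalExpr G σ E M (and a₁ a₂) (.int (n₁ &&& n₂)) := by
  unfold and
  split
  · simp [evalOp] at h₁
    subst h₁
    rw [BitVec.and_comm, ← Word.rolm_zero]
    exact evalExpr_rolm _ _ h₂
  · simp [evalOp] at h₂
    subst h₂
    rw [← Word.rolm_zero]
    exact evalExpr_rolm _ _ h₁
  · exact .op (.cons h₁ (.cons h₂ .nil)) rfl

theorem evalExpr_or {a₁ a₂ : Expr} {n₁ n₂ : Word} (h₁ : EvalExpr G σ E M a₁ (.int n₁))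
    (h₂ : EvalExpr G σ E M a₂ (.int n₂)) :
    EvalExpr G σ E M (or a₁ a₂) (.int (n₁ ||| n₂)) := by
  unfold or
  split
  · simp [evalOp] at h₁
    subst h₁
    rw [BitVec.or_comm]
    exact .op (.cons h₂ .nil) rfl
  · simp [evalOp] at h₂
    subst h₂
    exact .op (.cons h₁ .nil) rfl
  · split
    · rename_i h
      obtain ⟨rfl, rfl⟩ := h
      simp at h₁ h₂
      obtain ⟨w₁, h₁, e₁⟩ := h₁
      obtain ⟨w₂, h₂, e₂⟩ := h₂
      -- The arguments are equal as expressions, but come with two separate evaluations; determinism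
      -- gives them one value, so that the masks can be merged.
      obtain rfl := h₁.deterministic h₂
      cases w₁ <;> simp [evalOp] at e₁ e₂
      subst e₁ e₂
      rw [Word.rolm_or]
      exact .op (.cons h₁ .nil) rfl
    · exact .op (.cons h₁ (.cons h₂ .nil)) rfl
  · exact .op (.cons h₁ (.cons h₂ .nil)) rfl

theorem evalExpr_xor {a₁ a₂ : Expr} {n₁ n₂ : Word} (h₁ : EvalExpr G σ E M a₁ (.int n₁))
    (h₂ : EvalExpr G σ E M a₂ (.int n₂)) :
    EvalExpr G σ E M (xor a₁ a₂) (.int (n₁ ^^^ n₂)) := by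
  unfold xor
  split
  · simp [evalOp] at h₁
    subst h₁
    rw [BitVec.xor_comm]
    exact .op (.cons h₂ .nil) rfl
  · simp [evalOp] at h₂
    subst h₂
    exact .op (.cons h₁ .nil) rfl
  · exact .op (.cons h₁ (.cons h₂ .nil)) rfl

/-- Both operands occur twice in the selected code, which is sound because expressions have no side
effects. Leaving `d` and its quotient `q` abstract covers signed and unsigned remainders. -/
theorem evalExpr_modAux {d : Op} {a₁ a₂ : Expr} {n₁ n₂ q : Word}
    (h₁ : EvalExpr G σ E M a₁ (.int n₁)) (h₂ : EvalExpr G σ E M a₂ (.int n₂))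
    (hd : evalOp G σ d [.int n₁, .int n₂] = some (.int q)) :
    EvalExpr G σ E M (modAux d a₁ a₂) (.int (n₁ - q * n₂)) :=
  .op (.cons h₁ (.cons (.op (.cons (.op (.cons h₁ (.cons h₂ .nil)) hd) (.cons h₂ .nil)) rfl) .nil))
    rfl

-- Comparisons, negations, conditions and addressing modes.

theorem evalExpr_comp (c : Cmp) {a₁ a₂ : Expr} {v₁ v₂ : Val} {b : Bool}
    (h₁ : EvalExpr G σ E M a₁ v₁) (h₂ : EvalExpr G σ E M a₂ v₂)
    (hb : c.evalVal v₁ v₂ = some b) :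
    EvalExpr G σ E M (comp c a₁ a₂) (Val.ofBool b) := by
  unfold comp
  split
  · simp [evalOp] at h₁
    subst h₁
    refine .op (.cons h₂ .nil) ?_
    simp [evalOp, evalTest, Cmp.evalVal_swap_int, hb]
  · simp [evalOp] at h₂
    subst h₂
    refine .op (.cons h₁ .nil) ?_
    simp [evalOp, evalTest, hb]
  · refine .op (.cons h₁ (.cons h₂ .nil)) ?_
    simp [evalOp, evalTest, hb]

theorem evalExpr_compu (c : Cmp) {a₁ a₂ : Expr} {v₁ v₂ : Val} {b : Bool}
    (h₁ : EvalExpr G σ E M a₁ v₁) (h₂ : EvalExpr G σ E M a₂ v₂)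
    (hb : c.evalValu v₁ v₂ = some b) :
    EvalExpr G σ E M (compu c a₁ a₂) (Val.ofBool b) := by
  unfold compu
  split
  · simp [evalOp] at h₁
    subst h₁
    refine .op (.cons h₂ .nil) ?_
    simp [evalOp, evalTest, Cmp.evalValu_swap_int, hb]
  · simp [evalOp] at h₂
    subst h₂
    refine .op (.cons h₁ .nil) ?_
    simp [evalOp, evalTest, hb]
  · refine .op (.cons h₁ (.cons h₂ .nil)) ?_
    simp [evalOp, evalTest, hb]

theorem evalExpr_notint {a : Expr} {n : Word} (ha : EvalExpr G σ E M a (.int n)) :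
    EvalExpr G σ E M (notint a) (.int (~~~n)) := by
  unfold notint
  split
  iterate 3
    simp at ha ⊢
    obtain ⟨v₁, h₁, v₂, h₂, e⟩ := ha
    refine ⟨v₁, h₁, v₂, h₂, ?_⟩
    cases v₁ <;> cases v₂ <;> simp [evalOp] at e ⊢
    rw [e]
  · exact .op (.cons ha (.cons ha .nil)) (by simp [evalOp])

/-- Float `eq` and `ne` are complementary even on NaN, and `negTest` accepts no other float test. -/
theorem evalTest_negTest {c c' : Test} {vs : List Val} (h : negTest c = some c') :
    evalTest c' vs = (evalTest c vs).map (!·) := by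
  -- Tests take one or two operands; with any other number both sides are `none`.
  obtain _ | ⟨v, _ | ⟨w, _ | ⟨u, us⟩⟩⟩ := vs <;> unfold negTest at h <;> split at h <;> cases h <;>
    simp [evalTest, Cmp.evalVal_negate, Cmp.evalValu_negate]
  all_goals cases v <;> cases w <;> simp [Cmp.evalValf, Cmp.evalFloat]

theorem evalExpr_notbool {a : Expr} {v w : Val} (ha : EvalExpr G σ E M a v)
    (hw : evalOp G σ .notbool [v] = some w) : EvalExpr G σ E M (notbool a) w := by
  fun_induction notbool a with
  | case1 n =>
    simp [evalOp] at ha ⊢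
    subst ha
    simpa [evalOp, Val.ofBool] using hw
  | case2 c as c' hc =>
    rw [evalExpr_op_iff] at ha ⊢
    obtain ⟨vs, has, hv⟩ := ha
    refine ⟨vs, has, ?_⟩
    simp only [evalOp, evalTest_negTest hc, Option.map_eq_some_iff] at hv ⊢
    obtain ⟨b, hb, rfl⟩ := hv
    -- A test yields 0 or 1, on which `notbool` agrees with complementing the Boolean.
    cases b <;> simpa [hb, Val.ofBool, evalOp] using hw
  | case3 => exact .op (.cons ha .nil) hw
  | case4 ce a₁ a₂ ih₁ ih₂ =>
    cases ha with
    | cond_true hc h => exact .cond_true hc (ih₁ h)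
    | cond_false hc h => exact .cond_false hc (ih₂ h)
  | case5 => exact .op (.cons ha .nil) hw

theorem evalCond_negCond {ce : CondExpr} {b : Bool} (h : EvalCond G σ E M ce b) :
    EvalCond G σ E M (negCond ce) (!b) := by
  fun_induction negCond ce generalizing b with
  | case1 => cases h; exact .fls
  | case2 => cases h; exact .tru
  | case3 c as c' hc =>
    cases h with
    | test has hb => exact .test has (by simp [evalTest_negTest hc, hb])
  | case4 =>
    -- A float ordering cannot be negated as a test, so its outcome is inverted by the branches
    -- `fls` and `tru`.
    cases b
    · exact .cond_false h .tru
    · exact .cond_true h .fls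
  | case5 ce₁ ce₂ ce₃ ih₂ ih₃ =>
    cases h with
    | cond_true hc h => exact .cond_true hc (ih₂ h)
    | cond_false hc h => exact .cond_false hc (ih₃ h)

/-- A value with the given truth value. -/
def HasTruth (v : Val) (b : Bool) : Prop := if b then v.isTrue else v.isFalse

/-- Both truth values are treated in one induction because recognizing `notbool` exchanges them. The
default test against 0 is right for pointers as well, since a pointer always differs from null. -/
theorem evalCond_cond {a : Expr} {v : Val} {b : Bool} (ha : EvalExpr G σ E M a v)
    (hv : HasTruth v b) : EvalCond G σ E M (cond a) b := by
  fun_induction cond a generalizing v b with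
  | case1 =>
    simp [evalOp] at ha
    subst ha
    cases b <;> simp [HasTruth, Val.isTrue, Val.isFalse] at hv
    exact .fls
  | case2 n hn =>
    simp [evalOp] at ha
    subst ha
    cases b <;> simp [HasTruth, Val.isTrue, Val.isFalse] at hv
    · exact absurd hv hn
    · exact .tru
  | case3 a ih =>
    simp at ha
    obtain ⟨w, ha, e⟩ := ha
    -- This exposes the negation produced by `negCond`, so that the induction hypothesis is used at
    -- `!b`.
    rw [← Bool.not_not b]
    refine evalCond_negCond (ih ha ?_)
    cases w <;> simp [evalOp] at e <;> subst e <;> cases b <;>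
      simp_all [HasTruth, Val.isTrue, Val.isFalse, Val.ofBool]
  | case4 c as =>
    rw [evalExpr_op_iff] at ha
    obtain ⟨vs, has, e⟩ := ha
    simp only [evalOp, Option.map_eq_some_iff] at e
    obtain ⟨b', hb', rfl⟩ := e
    refine .test has ?_
    rw [hb']
    cases b <;> cases b' <;> simp_all [HasTruth, Val.isTrue, Val.isFalse, Val.ofBool]
  | case5 ce a₁ a₂ ih₁ ih₂ =>
    cases ha with
    | cond_true hc h => exact .cond_true hc (ih₁ h hv)
    | cond_false hc h => exact .cond_false hc (ih₂ h hv)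
  | case6 =>
    refine .test (.cons ha .nil) ?_
    cases v <;> cases b <;> simp_all [HasTruth, Val.isTrue, Val.isFalse, evalTest, Cmp.evalVal,
      Cmp.evalInt, Cmp.evalNull, Cmp.evalMismatch]

/-- Modes are defined only when they produce a pointer. Since the address is one, a sum combines one
pointer with one integer, as `based`, `indexed` and `indexed2` require; the fallback `indexed 0`
adds nothing. -/
theorem evalMode_mode {a : Expr} {b : Block} {δ : Word} (ha : EvalExpr G σ E M a (.ptr b δ)) :
    ∃ vs, EvalExprs G σ E M (mode a).2 vs ∧ evalMode G σ (mode a).1 vs = some (.ptr b δ) := by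
  unfold mode
  split
  · exact ⟨[], .nil, by simpa [evalOp, evalMode] using ha⟩
  · exact ⟨[], .nil, by simpa [evalOp, evalMode] using ha⟩
  · simp [evalOp] at ha
    obtain ⟨b', hb', v₂, h₂, e⟩ := ha
    refine ⟨_, .cons h₂ .nil, ?_⟩
    cases v₂ <;> simp_all [evalMode]
  · simp at ha
    obtain ⟨w, h, e⟩ := ha
    refine ⟨_, .cons h .nil, ?_⟩
    cases w <;> simp_all [evalOp, evalMode]
  · simp at ha
    obtain ⟨v₁, h₁, v₂, h₂, e⟩ := ha
    refine ⟨_, .cons h₁ (.cons h₂ .nil), ?_⟩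
    cases v₁ <;> cases v₂ <;> simp_all [evalOp, evalMode]
  · exact ⟨_, .cons ha .nil, by simp [evalMode]⟩

-- Correctness of all unary and binary operators.

set_option linter.unnecessarySimpa false in
theorem evalExpr_unop {op : Cminor.Unop} {a : Expr} {w v : Val} (ha : EvalExpr G σ E M a w)
    (hv : Cminor.evalUnop op w = some v) : EvalExpr G σ E M (unop op a) v := by
  cases op
  case notint =>
    cases w <;> simp [Cminor.evalUnop] at hv
    subst hv
    exact evalExpr_notint ha
  case notbool =>
    refine evalExpr_notbool ha ?_
    cases w <;> simpa [Cminor.evalUnop, evalOp] using hv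
  all_goals
    refine .op (.cons ha .nil) ?_
    cases w <;> simpa [Cminor.evalUnop, evalOp] using hv

set_option linter.unnecessarySimpa false in
theorem evalExpr_binop {op : Cminor.Binop} {a₁ a₂ : Expr} {v₁ v₂ v : Val}
    (h₁ : EvalExpr G σ E M a₁ v₁) (h₂ : EvalExpr G σ E M a₂ v₂)
    (hv : Cminor.evalBinop op v₁ v₂ = some v) : EvalExpr G σ E M (binop op a₁ a₂) v := by
  cases op
  case add =>
    refine evalExpr_add h₁ h₂ ?_
    cases v₁ <;> cases v₂ <;> simpa [Cminor.evalBinop, evalOp] using hv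
  case sub =>
    refine evalExpr_sub h₁ h₂ ?_
    cases v₁ <;> cases v₂ <;> simpa [Cminor.evalBinop, evalOp] using hv
  case cmp c =>
    simp only [Cminor.evalBinop, Option.map_eq_some_iff] at hv
    obtain ⟨b, hb, rfl⟩ := hv
    exact evalExpr_comp c h₁ h₂ hb
  case cmpu c =>
    simp only [Cminor.evalBinop, Option.map_eq_some_iff] at hv
    obtain ⟨b, hb, rfl⟩ := hv
    exact evalExpr_compu c h₁ h₂ hb
  case cmpf c => exact .op (.cons h₁ (.cons h₂ .nil)) hv
  case mul =>
    cases v₁ <;> cases v₂ <;> simp [Cminor.evalBinop] at hv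
    subst hv
    exact evalExpr_mul h₁ h₂
  case and =>
    cases v₁ <;> cases v₂ <;> simp [Cminor.evalBinop] at hv
    subst hv
    exact evalExpr_and h₁ h₂
  case or =>
    cases v₁ <;> cases v₂ <;> simp [Cminor.evalBinop] at hv
    subst hv
    exact evalExpr_or h₁ h₂
  case xor =>
    cases v₁ <;> cases v₂ <;> simp [Cminor.evalBinop] at hv
    subst hv
    exact evalExpr_xor h₁ h₂
  case shl =>
    cases v₁ <;> cases v₂ <;> simp only [Cminor.evalBinop, Option.ite_none_right_eq_some,
      reduceCtorEq, Option.some.injEq] at hv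
    obtain ⟨hn, rfl⟩ := hv
    exact evalExpr_shl h₁ h₂ hn
  case shr =>
    cases v₁ <;> cases v₂ <;> simp only [Cminor.evalBinop, Option.ite_none_right_eq_some,
      reduceCtorEq, Option.some.injEq] at hv
    obtain ⟨hn, rfl⟩ := hv
    exact evalExpr_shr h₁ h₂ hn
  case shru =>
    cases v₁ <;> cases v₂ <;> simp only [Cminor.evalBinop, Option.ite_none_right_eq_some,
      reduceCtorEq, Option.some.injEq] at hv
    obtain ⟨hn, rfl⟩ := hv
    exact evalExpr_shru h₁ h₂ hn
  case mod =>
    cases v₁ <;> cases v₂ <;> simp only [Cminor.evalBinop, Option.ite_none_left_eq_some,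
      reduceCtorEq, Option.some.injEq] at hv
    obtain ⟨hn, rfl⟩ := hv
    -- The remainder is put in the form that `modAux` computes.
    rw [← Word.sub_sdiv_mul]
    exact evalExpr_modAux h₁ h₂ (if_neg hn)
  case modu =>
    cases v₁ <;> cases v₂ <;> simp only [Cminor.evalBinop, Option.ite_none_left_eq_some,
      reduceCtorEq, Option.some.injEq] at hv
    obtain ⟨hn, rfl⟩ := hv
    rw [← Word.sub_udiv_mul]
    exact evalExpr_modAux h₁ h₂ (if_neg hn)
  -- What is left, the two divisions and float arithmetic, maps to a machine operator with the same
  -- semantics.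
  all_goals
    refine .op (.cons h₁ (.cons h₂ .nil)) ?_
    cases v₁ <;> cases v₂ <;> simpa [Cminor.evalBinop, evalOp] using hv

end

-- From expressions to programs: the lock-step simulation.

section
variable (P : Cminor.Program)

/-- Blocks are assigned by position in the lists of functions and variables, and translation
preserves positions and names. -/
theorem symbol_program (id : Ident) :
    (program P).globalEnv.symbol id = P.globalEnv.symbol id := by
  simp [Prog.globalEnv, program, Prog.map, List.findIdx?_map, Function.comp_def]

theorem funct_program (b : Block) :
    (program P).globalEnv.funct b = (P.globalEnv.funct b).map fundef := by
  by_cases hb : b < 0 <;>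
    simp [Prog.globalEnv, program, Prog.map, hb, fundef, Function.comp_def]

variable {P} {σ : Block} {E : Env} {M : Mem}

/-- Each evaluation rule is answered by the corresponding smart constructor; only constants consult
the global environment, through symbol addresses. -/
theorem evalExpr_expr {a : Cminor.Expr} {v : Val}
    (h : Cminor.EvalExpr P.globalEnv σ E M a v) :
    EvalExpr (program P).globalEnv σ E M (expr a) v := by
  induction h with
  | var h => exact .var h
  | @const c v h =>
    cases c <;> exact .op .nil (by simpa [Cminor.evalConst, evalOp, symbol_program] using h)
  | unop _ hv ih => exact evalExpr_unop ih hv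
  | binop _ _ hv ih₁ ih₂ => exact evalExpr_binop ih₁ ih₂ hv
  | load _ hl ih =>
    obtain ⟨vs, hvs, hm⟩ := evalMode_mode ih
    exact .load hvs hm hl
  | cond_true _ hv _ ih₁ ih₂ => exact .cond_true (evalCond_cond (b := true) ih₁ hv) ih₂
  | cond_false _ hv _ ih₁ ih₃ => exact .cond_false (evalCond_cond (b := false) ih₁ hv) ih₃

theorem evalExprs_exprs {as : List Cminor.Expr} {vs : List Val}
    (h : Cminor.EvalExprs P.globalEnv σ E M as vs) :
    EvalExprs (program P).globalEnv σ E M (exprs as) vs := by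
  induction h with
  | nil => exact .nil
  | cons h _ ih => exact .cons (evalExpr_expr h) ih

theorem sigOf_fundef (Fd : Cminor.Fundef) : sigOf (fundef Fd) = Cminor.sigOf Fd := by
  cases Fd <;> rfl

theorem callcont_cont (k : Cminor.Cont) : callcont (cont k) = cont (Cminor.callcont k) := by
  induction k with
  | empty => rfl
  | seq s k ih => exact ih
  | endblock k ih => exact ih
  | returnto => rfl

theorem isCall_cont {k : Cminor.Cont} (h : k.isCall) : (cont k).isCall := by
  cases k <;> exact h

/-- The search extends the continuation as it descends, hence the induction for all `k`. The
equality of options also transfers failure in a first branch, which decides whether the second is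
searched. -/
theorem findlabel_stmt (lbl : Label) (s : Cminor.Stmt) (k : Cminor.Cont) :
    findlabel lbl (stmt s) (cont k) =
      (Cminor.findlabel lbl s k).map fun r => (stmt r.1, cont r.2) := by
  induction s generalizing k with
  | seq s₁ s₂ ih₁ ih₂ =>
    have h := ih₁ (.seq s₂ k)
    rw [cont] at h
    rw [stmt, findlabel, Cminor.findlabel, h, ih₂]
    cases Cminor.findlabel lbl s₁ (.seq s₂ k) <;> rfl
  | ite a s₁ s₂ ih₁ ih₂ =>
    rw [stmt, findlabel, Cminor.findlabel, ih₁, ih₂]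
    cases Cminor.findlabel lbl s₁ k <;> rfl
  | loop s ih =>
    have h := ih (.seq (.loop s) k)
    rw [cont, stmt] at h
    rw [stmt, findlabel, Cminor.findlabel, h]
  | block s ih =>
    have h := ih (.endblock k)
    rw [cont] at h
    rw [stmt, findlabel, Cminor.findlabel, h]
  | label lbl' s ih =>
    rw [stmt, findlabel, Cminor.findlabel, ih]
    split <;> rfl
  | ret a => cases a <;> rfl
  | _ => rfl

/-- `Match` makes `S₁'` the translation of `S₁`, with the same memory, and every rule is matched by
the rule of the same name; only its premises on expressions, labels and functions need transfer. -/
theorem step_simulation {S₁ S₂ : Cminor.State} {t : Trace} {S₁' : State}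
    (h : Cminor.Step P.globalEnv S₁ t S₂) (hm : Match S₁ S₁') :
    ∃ S₂', Step (program P).globalEnv S₁' t S₂' ∧ Match S₂ S₂' := by
  cases h
  case skip_seq => cases hm; exact ⟨_, .skip_seq, .regular⟩
  case skip_endblock => cases hm; exact ⟨_, .skip_endblock, .regular⟩
  case assign h => cases hm; exact ⟨_, .assign (evalExpr_expr h), .regular⟩
  case store h₁ h₂ hs =>
    cases hm
    obtain ⟨vs, hvs, hmode⟩ := evalMode_mode (evalExpr_expr h₁)
    exact ⟨_, .store hvs hmode (evalExpr_expr h₂) hs, .regular⟩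
  case seq => cases hm; exact ⟨_, .seq, .regular⟩
  case ite_true h hv =>
    cases hm
    exact ⟨_, .ite_true (evalCond_cond (b := true) (evalExpr_expr h) hv), .regular⟩
  case ite_false h hv =>
    cases hm
    exact ⟨_, .ite_false (evalCond_cond (b := false) (evalExpr_expr h) hv), .regular⟩
  case loop => cases hm; exact ⟨_, .loop, .regular⟩
  case block => cases hm; exact ⟨_, .block, .regular⟩
  case exit_seq => cases hm; exact ⟨_, .exit_seq, .regular⟩
  case exit_zero => cases hm; exact ⟨_, .exit_zero, .regular⟩
  case exit_succ => cases hm; exact ⟨_, .exit_succ, .regular⟩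
  case switch h => cases hm; exact ⟨_, .switch (evalExpr_expr h), .regular⟩
  case label => cases hm; exact ⟨_, .label, .regular⟩
  case goto h =>
    cases hm
    refine ⟨_, .goto ?_, .regular⟩
    rw [callcont_cont, func, findlabel_stmt, h]
    rfl
  case call h hs hf hsig =>
    cases hm
    refine ⟨_, .call (evalExpr_expr h) (evalExprs_exprs hs) ?_ (hsig ▸ sigOf_fundef _), .call⟩
    rw [funct_program, hf]
    rfl
  case tailcall h hs hf hsig =>
    cases hm
    refine ⟨_, .tailcall (evalExpr_expr h) (evalExprs_exprs hs) ?_ (hsig ▸ sigOf_fundef _), ?_⟩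
    · rw [funct_program, hf]
      rfl
    · rw [callcont_cont]
      exact .call
  case skip_call hr hk => cases hm; exact ⟨_, .skip_call hr (isCall_cont hk), .ret⟩
  case ret_none hr =>
    cases hm
    exact ⟨_, .ret_none hr, callcont_cont _ ▸ .ret⟩
  case ret_some hr h =>
    cases hm
    exact ⟨_, .ret_some hr (evalExpr_expr h), callcont_cont _ ▸ .ret⟩
  case internal h => cases hm; exact ⟨_, .internal h, .regular⟩
  case external h => cases hm; exact ⟨_, .external h, .ret⟩
  case ret => cases hm; exact ⟨_, .ret, .regular⟩

theorem initial_simulation {S : Cminor.State} (h : Cminor.Initial P S) :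
    ∃ S', Initial (program P) S' ∧ Match S S' := by
  obtain ⟨hs, hf⟩ := h
  refine ⟨_, .intro (Fd := fundef _) ((symbol_program P _).trans hs) ?_, .call⟩
  rw [funct_program, hf]
  rfl

theorem final_simulation {S : Cminor.State} {S' : State} {n : Word} (hm : Match S S')
    (h : Cminor.Final S n) : Final S' n := by
  cases h
  cases hm
  exact .intro

end

end Selection

-- Lock-step simulations and observable behaviors.

section
variable {S S' : Type} {step : S → Trace → S → Prop} {step' : S' → Trace → S' → Prop}
  {R : S → S' → Prop}

/-- `R` is a lock-step simulation of `step` by `step'`. -/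
def IsSimulation (step : S → Trace → S → Prop) (step' : S' → Trace → S' → Prop)
    (R : S → S' → Prop) : Prop :=
  ∀ ⦃s₁ t s₂ s₁'⦄, step s₁ t s₂ → R s₁ s₁' → ∃ s₂', step' s₁' t s₂' ∧ R s₂ s₂'

theorem IsSimulation.star (hR : IsSimulation step step' R) {s₁ s₂ : S} {t : Trace} {s₁' : S'}
    (h : Star step s₁ t s₂) (hs : R s₁ s₁') : ∃ s₂', Star step' s₁' t s₂' ∧ R s₂ s₂' := by
  induction h generalizing s₁' with
  | refl s => exact ⟨_, .refl _, hs⟩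
  | step h _ ih =>
    obtain ⟨u, hu, hru⟩ := hR h hs
    obtain ⟨w, hw, hrw⟩ := ih hru
    exact ⟨w, .step hu hw, hrw⟩

theorem IsSimulation.forever (hR : IsSimulation step step' R) {s : S} {T : TraceInf} {s' : S'}
    (h : Forever step s T) (hs : R s s') : Forever step' s' T := by
  obtain ⟨Q, hQ, hstep⟩ := h
  -- Coinduction: the invariant for the target is the source invariant `Q` transported along `R`.
  refine ⟨fun u' T => ∃ u, Q u T ∧ R u u', ⟨s, hQ, hs⟩, ?_⟩
  rintro u' T ⟨u, hu, hr⟩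
  obtain ⟨t, w, T', hw, hT, hQw⟩ := hstep u T hu
  obtain ⟨w', hw', hrw⟩ := hR hw hr
  exact ⟨t, w', T', hw', hT, w, hQw, hrw⟩

/-- Wrong behaviors are excluded because a forward simulation says nothing about the target once the
source is stuck: the target may still have transitions. -/
theorem IsSimulation.behaves (hR : IsSimulation step step' R) {initial : S → Prop}
    {initial' : S' → Prop} {final : S → Word → Prop} {final' : S' → Word → Prop}
    (hinitial : ∀ ⦃s⦄, initial s → ∃ s', initial' s' ∧ R s s')
    (hfinal : ∀ ⦃s s' n⦄, R s s' → final s n → final' s' n) {B : Behavior}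
    (h : Behaves step initial final B) (hB : B ∉ Wrong) : Behaves step' initial' final' B := by
  cases h with
  | converges hi hs hf =>
    obtain ⟨u, hu, hr⟩ := hinitial hi
    obtain ⟨w, hw, hr'⟩ := hR.star hs hr
    exact .converges hu hw (hfinal hr' hf)
  | diverges hi hs =>
    obtain ⟨u, hu, hr⟩ := hinitial hi
    exact .diverges hu (hR.forever hs hr)
  | goesWrong => exact absurd ⟨_, rfl⟩ hB

end

theorem Selection.exec_program {P : Cminor.Program} {B : Behavior} (h : Cminor.Exec P B)
    (hB : B ∉ Wrong) : CminorSel.Exec (Selection.program P) B := by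
  have hsim : IsSimulation (Cminor.Step P.globalEnv)
      (CminorSel.Step (Selection.program P).globalEnv) Selection.Match :=
    fun _ _ _ _ => Selection.step_simulation
  exact hsim.behaves (initial := Cminor.Initial P) (final := Cminor.Final)
    (final' := CminorSel.Final) (fun _ => Selection.initial_simulation)
    (fun _ _ _ => Selection.final_simulation) h hB

end BackEnd

open BackEnd in
theorem lemmal (P : Cminor.Program) (P' : CminorSel.Program) (hP' : P' = Selection.program P) :
    -- correctness of the smart constructors
    (∀ (G : GEnv CminorSel.Func) (σ : Block) (E : Env) (M : Mem),
      (∀ (op : Cminor.Unop) (a₁ : CminorSel.Expr) (v₁ v : Val),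
        CminorSel.EvalExpr G σ E M a₁ v₁ → Cminor.evalUnop op v₁ = some v →
        CminorSel.EvalExpr G σ E M (Selection.unop op a₁) v) ∧
      (∀ (op : Cminor.Binop) (a₁ a₂ : CminorSel.Expr) (v₁ v₂ v : Val),
        CminorSel.EvalExpr G σ E M a₁ v₁ → CminorSel.EvalExpr G σ E M a₂ v₂ →
        Cminor.evalBinop op v₁ v₂ = some v →
        CminorSel.EvalExpr G σ E M (Selection.binop op a₁ a₂) v) ∧
      (∀ (a : CminorSel.Expr) (v : Val),
        CminorSel.EvalExpr G σ E M a v → v.isTrue →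
        CminorSel.EvalCond G σ E M (Selection.cond a) true) ∧
      (∀ (a : CminorSel.Expr) (v : Val),
        CminorSel.EvalExpr G σ E M a v → v.isFalse →
        CminorSel.EvalCond G σ E M (Selection.cond a) false) ∧
      (∀ (a : CminorSel.Expr) (b : Block) (δ : Word),
        CminorSel.EvalExpr G σ E M a (.ptr b δ) →
        ∃ vs, CminorSel.EvalExprs G σ E M (Selection.mode a).2 vs ∧
          CminorSel.evalMode G σ (Selection.mode a).1 vs = some (.ptr b δ))) ∧
    -- correctness of the translation of expressions
    (∀ (σ : Block) (E : Env) (M : Mem) (a : Cminor.Expr) (v : Val),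
      Cminor.EvalExpr P.globalEnv σ E M a v →
      CminorSel.EvalExpr P'.globalEnv σ E M (Selection.expr a) v) ∧
    -- lock-step simulation
    (∀ (S₁ S₂ : Cminor.State) (t : Trace) (S₁' : CminorSel.State),
      Cminor.Step P.globalEnv S₁ t S₂ → Selection.Match S₁ S₁' →
      ∃ S₂', CminorSel.Step P'.globalEnv S₁' t S₂' ∧ Selection.Match S₂ S₂') ∧
    -- preservation of observable behaviors
    (∀ B : Behavior, Cminor.Exec P B → B ∉ Wrong → CminorSel.Exec P' B) := by
  subst hP'
  exact ⟨fun _ _ _ _ =>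
      ⟨fun _ _ _ _ => Selection.evalExpr_unop, fun _ _ _ _ _ _ => Selection.evalExpr_binop,
        fun _ _ => Selection.evalCond_cond (b := true),
        fun _ _ => Selection.evalCond_cond (b := false), fun _ _ _ => Selection.evalMode_mode⟩,
    fun _ _ _ _ _ => Selection.evalExpr_expr,
    fun _ _ _ _ => Selection.step_simulation,
    fun _ => Selection.exec_program⟩
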